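/- Let $\mathcal R$ and $\mathcal B$ be homogeneous Poisson processes on $\mathbb R$ with intensities $\lambda_{\mathcal R},\lambda_{\mathcal B}\in(0,\infty)$; their points are called red and blue, respectively. Let $\nu$ and $\mu$ be probability laws on the strictly positive integers with $$\lambda_{\mathcal R}\,\mathbb E[X]=\lambda_{\mathcal B}\,\mathbb E[Y],\qquad X\sim\nu,\ Y\sim\mu .$$ Conditionally on $\mathcal R$, let the red points $x$ carry i.i.d. numbers $X_x$ with law $\nu$ and, conditionally on $\mathcal B$, let the blue points $y$ carry i.i.d. numbers $Y_y$ with law $\mu$; the two marked Poisson processes are independent. A two-color multi-matching is a random simple graph whose vertices are the red and blue points, such that almost surely every edge joins a red point and a blue point, every red point $x$ has degree $X_x$ and every blue point $y$ has degree $Y_y$. It is stable if almost surely, for any two distinct points $x,y$ of different color, either $x$ and $y$ are joined by an edge or at least one of $x$ and $y$ has no incident edge longer than $|x-y|$. For a vertex $x$ let $M_x$ be the length of the longest edge at $x$, and say that $x$ desires a point $y\in\mathbb R$ if $|x-y|<M_x$. Proposition. In a two-color stable multi-matching, for any degree distributions $\nu,\mu$ as above, the number $N$ of blue points that desire the origin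 is infinite almost surely. -/

import Mathlib

open MeasureTheory ProbabilityTheory
open scoped NNReal ENNReal

namespace StableMatching

/-- The counting measure `∑ i, δ_{x i}` of a sequence of points of the real line. -/
noncomputable def countingMeasure (x : ℕ → ℝ) : Measure ℝ :=
  Measure.sum fun i => Measure.dirac (x i)

/-- The random points `T 0, T 1, …` enumerate, without repetition, a homogeneous Poisson process on
`ℝ` of intensity `lam`: the number of points in a Borel set of finite length `ℓ` has the Poisson
law of parameter `lam * ℓ`, and the numbers of points in disjoint Borel sets are independent.
(For `lam > 0` such a process has infinitely many points almost surely, so that they can be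
indexed by `ℕ`.) -/
structure IsPoissonProcess {Ω : Type*} [MeasurableSpace Ω] (P : Measure Ω) (lam : ℝ≥0)
    (T : ℕ → Ω → ℝ) : Prop where
  measurable_point : ∀ i, Measurable (T i)
  ae_injective : ∀ᵐ ω ∂P, Function.Injective fun i => T i ω
  hasLaw_count : ∀ A : Set ℝ, MeasurableSet A → volume A ≠ ∞ →
    HasLaw (fun ω => countingMeasure (fun i => T i ω) A)
      ((poissonMeasure (lam * (volume A).toNNReal)).map fun n : ℕ => (n : ℝ≥0∞)) P
  indep_count : ∀ (n : ℕ) (A : Fin n → Set ℝ), (∀ j, MeasurableSet (A j)) →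
    Pairwise (Function.onFun Disjoint A) →
    iIndepFun (fun j ω => countingMeasure (fun i => T i ω) (A j)) P

/-- An independently marked Poisson process: the point `T i` carries the mark (number of stubs)
`D i`, and, given the points, the marks are i.i.d. with law `ν`. -/
structure IsMarkedPoissonProcess {Ω : Type*} [MeasurableSpace Ω] (P : Measure Ω) (lam : ℝ≥0)
    (ν : Measure ℕ) (T : ℕ → Ω → ℝ) (D : ℕ → Ω → ℕ) : Prop where
  poisson : IsPoissonProcess P lam T
  measurable_mark : ∀ i, Measurable (D i)
  hasLaw_mark : ∀ i, HasLaw (D i) ν P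
  indep_mark : iIndepFun D P
  indep_point_mark : IndepFun (fun ω i => T i ω) (fun ω i => D i ω) P

/-- The simple graph `G` is a two-color multi-matching of the red points `r i`, which carry `dr i`
stubs, and the blue points `b j`, which carry `db j` stubs: every edge joins a red point and a blue
point, and the degree of every point is its number of stubs. -/
structure IsMultiMatching (r : ℕ → ℝ) (dr : ℕ → ℕ) (b : ℕ → ℝ) (db : ℕ → ℕ)
    (G : SimpleGraph ℝ) : Prop where
  bipartite : ∀ x y, G.Adj x y →
    (x ∈ Set.range r ∧ y ∈ Set.range b) ∨ (x ∈ Set.range b ∧ y ∈ Set.range r)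
  degree_red : ∀ i, (G.neighborSet (r i)).encard = dr i
  degree_blue : ∀ j, (G.neighborSet (b j)).encard = db j

/-- A two-color multi-matching is stable if any two distinct points `x`, `y` of different color are
linked by an edge, or at least one of them has no incident edge longer than `|x - y|`. -/
structure IsStableMultiMatching (r : ℕ → ℝ) (dr : ℕ → ℕ) (b : ℕ → ℝ) (db : ℕ → ℕ)
    (G : SimpleGraph ℝ) : Prop extends IsMultiMatching r dr b db G where
  stable : ∀ x ∈ Set.range r, ∀ y ∈ Set.range b, x ≠ y →
    G.Adj x y ∨ (∀ z, G.Adj x z → |x - z| ≤ |x - y|) ∨ (∀ z, G.Adj y z → |y - z| ≤ |x - y|)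

/-- The length of the longest edge of `G` at `x`. -/
noncomputable def longestEdge (G : SimpleGraph ℝ) (x : ℝ) : ℝ≥0∞ :=
  ⨆ z ∈ G.neighborSet x, ENNReal.ofReal |x - z|

/-- `x` desires `y` if `y` is closer to `x` than the far end of the longest edge at `x`. -/
def Desires (G : SimpleGraph ℝ) (x y : ℝ) : Prop :=
  ENNReal.ofReal |x - y| < longestEdge G x

end StableMatching

/-!
The blue points that desire a point of the line are counted through a perturbation argument: red
points are added, and the resulting process is still absolutely continuous with respect to the old
one, hence still admits a perfect stable matching; but the added points must find their partners
among the blue points that already desired their positions.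

*Deterministic part.* Without ties, a perfect stable matching is a fixed point of `Step`: a pair is
matched if and only if both ends still have a free stub when all shorter pairs have been treated. As
a Poisson process has gaps of every length, a chain of pairs of decreasing lengths cannot escape to
infinity; so pairs carry a natural-number rank (`exists_rank`), the fixed point is unique, and it is
the limit of the greedy algorithm (`eq_limitGreedy`). In particular the stable matching is a
measurable function of the points and their marks, whatever the measurability of the given matching.
Induction on the rank shows that additional red points only help blue points
(`encard_le_of_extension`). A far blue point that desires a point of `[a, b]` also desires an end of
`[a, b]`; so if both ends are desired by finitely many blue points only, then only a bounded number
of red points can be added in `[a, b]` (`exists_no_perfect_extension`).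

*Probabilistic part.* The counts of a Poisson process in finitely many sets are functions of
independent Poisson variables, those of the atoms. This yields the uniqueness of the law and the
Mecke equation for the vector of all counts in the intervals between the origin and a rational
number (`IsPoissonProcess.map_countVec_eq`, `IsPoissonProcess.mecke`). These counts determine the
points up to their order (`Scattered.exists_decode_eq`), so both facts apply to all measurable
functions that are invariant under permutations of the points; independent marks are integrated out.
By the Mecke equation, almost surely a perfect stable matching persists when red points are added at
almost all positions (`ae_afterAdding`), so almost surely at most one point of the line is desired
by finitely many blue points only (`ae_not_finitelyDesired_pair`). By translation invariance each
natural number is such a point with the same probability, which therefore is zero.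
-/

namespace StableMatching

/-! ### Greedy stable matchings of deterministic configurations -/

/-- The distance between the red point `i` and the blue point `j`; a configuration of points of one
color is a sequence of pairs (position, number of stubs). -/
def gap (p q : ℕ → ℝ × ℕ) (i j : ℕ) : ℝ := |(p i).1 - (q j).1|

/-- One round of the greedy algorithm: the pair `(i, j)` is accepted if, counting only the strictly
shorter pairs of `S`, both of its ends still have a free stub. -/
def Step (p q : ℕ → ℝ × ℕ) (S : ℕ → ℕ → Prop) (i j : ℕ) : Prop :=
  {j' | gap p q i j' < gap p q i j ∧ S i j'}.encard < (p i).2 ∧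
    {i' | gap p q i' j < gap p q i j ∧ S i' j}.encard < (q j).2

/-- No point is at the same distance from two points of the other color. -/
structure NoTies (p q : ℕ → ℝ × ℕ) : Prop where
  red : ∀ i j j', gap p q i j = gap p q i j' → j = j'
  blue : ∀ i i' j, gap p q i j = gap p q i' j → i = i'

/-- The relation `S` between indices is a stable perfect matching. In the absence of ties, stability
amounts to being a fixed point of `Step`. -/
structure IsPerfect (p q : ℕ → ℝ × ℕ) (S : ℕ → ℕ → Prop) : Prop where
  step_iff : ∀ i j, S i j ↔ Step p q S i j
  degree_red : ∀ i, {j | S i j}.encard = (p i).2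
  degree_blue : ∀ j, {i | S i j}.encard = (q j).2

/-- The rounds of the greedy algorithm, started from the empty relation. -/
def greedy (p q : ℕ → ℝ × ℕ) : ℕ → ℕ → ℕ → Prop
  | 0 => fun _ _ => False
  | n + 1 => Step p q (greedy p q n)

/-- The pairs that the greedy algorithm accepts from some round on. -/
def limitGreedy (p q : ℕ → ℝ × ℕ) (i j : ℕ) : Prop := ∃ n, ∀ m, n ≤ m → greedy p q m i j

/-- Only finitely many points lie in each bounded set. -/
def LocFin (p : ℕ → ℝ × ℕ) : Prop := ∀ L : ℝ, {i | |(p i).1| ≤ L}.Finite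

/-- Empty intervals of every length occur arbitrarily far on both sides. -/
def HasGaps (q : ℕ → ℝ × ℕ) : Prop :=
  ∀ D L : ℝ, (∃ s, L ≤ s ∧ ∀ j, (q j).1 ∉ Set.Icc s (s + D)) ∧
    ∃ s, s ≤ L ∧ ∀ j, (q j).1 ∉ Set.Icc (s - D) s

/-- `e'` shares an end with `e` and is strictly shorter. -/
def Prec (p q : ℕ → ℝ × ℕ) (e' e : ℕ × ℕ) : Prop :=
  (e'.1 = e.1 ∨ e'.2 = e.2) ∧ gap p q e'.1 e'.2 < gap p q e.1 e.2

theorem LocFin.finite_Icc {p : ℕ → ℝ × ℕ} (hp : LocFin p) (a b : ℝ) :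
    {i | a ≤ (p i).1 ∧ (p i).1 ≤ b}.Finite := by
  refine (hp (max |a| |b|)).subset fun i hi => ?_
  exact abs_le_max_abs_abs hi.1 hi.2

/-- A descending chain of adjacent pairs that starts with length `D` never crosses an interval of
length `2 * D` without blue points, so only finitely many pairs can be reached. -/
theorem finite_transGen {p q : ℕ → ℝ × ℕ} (hp : LocFin p) (hq : LocFin q) (hg : HasGaps q)
    (e : ℕ × ℕ) : {e' | Relation.TransGen (Prec p q) e' e}.Finite := by
  set D := gap p q e.1 e.2 with hD
  obtain ⟨⟨s, hs, hs'⟩, -⟩ := hg (2 * D) (q e.2).1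
  obtain ⟨-, ⟨t, ht, ht'⟩⟩ := hg (2 * D) (q e.2).1
  have hD0 : 0 ≤ D := abs_nonneg _
  -- All blue points reached lie between the two gaps: consecutive blue points of a chain share a red
  -- partner at distance at most `D`.
  have key : ∀ e', Relation.TransGen (Prec p q) e' e →
      (t ≤ (q e'.2).1 ∧ (q e'.2).1 ≤ s) ∧ gap p q e'.1 e'.2 ≤ D := by
    have step : ∀ e'' e' : ℕ × ℕ, Prec p q e'' e' →
        ((t ≤ (q e'.2).1 ∧ (q e'.2).1 ≤ s) ∧ gap p q e'.1 e'.2 ≤ D) →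
        ((t ≤ (q e''.2).1 ∧ (q e''.2).1 ≤ s) ∧ gap p q e''.1 e''.2 ≤ D) := by
      rintro ⟨i, j⟩ ⟨i', j'⟩ ⟨h, hlt⟩ ⟨⟨h1, h2⟩, h3⟩
      simp only at *
      refine ⟨?_, hlt.le.trans h3⟩
      rcases h with rfl | rfl
      · have h4 := hlt.trans_le h3
        simp only [gap] at h3 h4
        rw [abs_lt] at h4
        rw [abs_le] at h3
        have a1 := hs' j
        have a2 := ht' j
        simp only [Set.mem_Icc, not_and_or, not_le] at a1 a2
        constructor
        · rcases a2 with a2 | a2 <;> linarith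
        · rcases a1 with a1 | a1 <;> linarith
      · exact ⟨h1, h2⟩
    intro e' h
    induction h using Relation.TransGen.head_induction_on with
    | single h => exact step _ _ h ⟨⟨ht, hs⟩, le_rfl⟩
    | head h _ ih => exact step _ _ h ih
  refine ((hp.finite_Icc (t - D) (s + D)).prod (hq.finite_Icc t s)).subset fun e' he' => ?_
  obtain ⟨h1, h2⟩ := key e' he'
  refine ⟨?_, h1⟩
  rw [gap, abs_le] at h2
  constructor <;> linarith [h1.1, h1.2]

theorem Prec.gap_lt_of_transGen {p q : ℕ → ℝ × ℕ} {e' e : ℕ × ℕ}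
    (h : Relation.TransGen (Prec p q) e' e) : gap p q e'.1 e'.2 < gap p q e.1 e.2 := by
  induction h with
  | single h => exact h.2
  | tail _ h ih => exact ih.trans h.2

/-- Pairs of points can be ranked by natural numbers compatibly with `Prec`; this replaces the
absence of infinite descending chains. -/
theorem exists_rank {p q : ℕ → ℝ × ℕ} (hp : LocFin p) (hq : LocFin q) (hg : HasGaps q) :
    ∃ ρ : ℕ × ℕ → ℕ, ∀ e' e, Prec p q e' e → ρ e' < ρ e := by
  refine ⟨fun e => {e' | Relation.TransGen (Prec p q) e' e}.ncard, fun e' e h => ?_⟩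
  refine Set.ncard_lt_ncard ?_ (finite_transGen hp hq hg e)
  refine ⟨fun e'' h' => h'.tail h, fun hsub => ?_⟩
  exact lt_irrefl _ (Prec.gap_lt_of_transGen (hsub (Relation.TransGen.single h)))

/-- A stable matching is the limit of the greedy algorithm. -/
theorem eq_limitGreedy {p q : ℕ → ℝ × ℕ} {ρ : ℕ × ℕ → ℕ}
    (hρ : ∀ e' e, Prec p q e' e → ρ e' < ρ e) {S : ℕ → ℕ → Prop}
    (hS : ∀ i j, S i j ↔ Step p q S i j) : S = limitGreedy p q := by
  have key : ∀ m i j, ρ (i, j) < m → (greedy p q m i j ↔ S i j) := by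
    intro m
    induction m with
    | zero => intro i j h; omega
    | succ m ih =>
      intro i j h
      rw [hS, greedy, Step, Step]
      have h1 : {j' | gap p q i j' < gap p q i j ∧ greedy p q m i j'} =
          {j' | gap p q i j' < gap p q i j ∧ S i j'} := by
        ext j'
        refine and_congr_right fun hlt => ih i j' ?_
        have := hρ (i, j') (i, j) ⟨Or.inl rfl, hlt⟩
        omega
      have h2 : {i' | gap p q i' j < gap p q i j ∧ greedy p q m i' j} =
          {i' | gap p q i' j < gap p q i j ∧ S i' j} := by
        ext i'
        refine and_congr_right fun hlt => ih i' j ?_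
        have := hρ (i', j) (i, j) ⟨Or.inr rfl, hlt⟩
        omega
      rw [h1, h2]
  ext i j
  constructor
  · exact fun h => ⟨ρ (i, j) + 1, fun m hm => (key m i j (by omega)).2 h⟩
  · rintro ⟨n, hn⟩
    exact (key (max n (ρ (i, j) + 1)) i j (by omega)).1 (hn _ (le_max_left _ _))

/-- If `s` is a finite nonempty set then removing from it the point where an injective function `f`
is largest leaves the points of `s` with smaller value. -/
theorem exists_encard_eq_add_one {s : Set ℕ} (hs : s.Finite) (hne : s.Nonempty) {f : ℕ → ℝ}
    (hf : ∀ a b, f a = f b → a = b) :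
    ∃ a ∈ s, s.encard = {b | f b < f a ∧ b ∈ s}.encard + 1 := by
  obtain ⟨a, ha, hmax⟩ := Set.exists_max_image s f hs hne
  refine ⟨a, ha, ?_⟩
  have : s = insert a {b | f b < f a ∧ b ∈ s} := by
    ext b
    simp only [Set.mem_insert_iff, Set.mem_ofPred_eq]
    constructor
    · intro hb
      rcases (hmax b hb).lt_or_eq with h | h
      · exact Or.inr ⟨h, hb⟩
      · exact Or.inl (hf _ _ h)
    · rintro (rfl | h)
      exacts [ha, h.2]
  conv_lhs => rw [this]
  exact Set.encard_insert_of_notMem (by simp)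

/-- `j` desires `z` in the matching `S`. -/
def DesiresIn (p q : ℕ → ℝ × ℕ) (S : ℕ → ℕ → Prop) (z : ℝ) (j : ℕ) : Prop :=
  ∃ i, S i j ∧ |(q j).1 - z| < gap p q i j

section Monotone

variable {p p' q : ℕ → ℝ × ℕ} {S S' : ℕ → ℕ → Prop} {ι : ℕ → ℕ}

/-- Adding red points improves the situation of the blue points and worsens that of the old red
points: below any length, blue points acquire at least as many partners as before, and red points
at most as many. -/
theorem encard_le_of_extension (hι : Function.Injective ι) (hp : ∀ i, p' (ι i) = p i)
    (hties : NoTies p' q) {ρ : ℕ × ℕ → ℕ} (hρ : ∀ e' e, Prec p' q e' e → ρ e' < ρ e)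
    (hS : IsPerfect p q S) (hS' : IsPerfect p' q S') (k j : ℕ) :
    {i | gap p' q (ι i) j < gap p' q k j ∧ S i j}.encard ≤
        {k' | gap p' q k' j < gap p' q k j ∧ S' k' j}.encard ∧
      ∀ i, k = ι i → {j' | gap p' q k j' < gap p' q k j ∧ S' k j'}.encard ≤
        {j' | gap p' q k j' < gap p' q k j ∧ S i j'}.encard := by
  have hgap : ∀ i j, gap p' q (ι i) j = gap p q i j := fun i j => by rw [gap, gap, hp]
  induction hn : ρ (k, j) using Nat.strong_induction_on generalizing k j with
  | _ n ih =>
  subst hn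
  -- In both halves the counted set is compared through its longest pair, to which the induction
  constructor
  · rcases Set.eq_empty_or_nonempty {i | gap p' q (ι i) j < gap p' q k j ∧ S i j} with he | hne
    · rw [he]; simp
    obtain ⟨i, ⟨hlt, hSi⟩, hcard⟩ := exists_encard_eq_add_one
      ((Set.finite_of_encard_eq_coe (hS.degree_blue j)).subset (fun i hi => hi.2)) hne
      (f := fun i => gap p' q (ι i) j) (fun a b h => hι (hties.blue _ _ _ h))
    have hset : {b | gap p' q (ι b) j < gap p' q (ι i) j ∧
        b ∈ {i | gap p' q (ι i) j < gap p' q k j ∧ S i j}} =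
        {b | gap p' q (ι b) j < gap p' q (ι i) j ∧ S b j} := by
      ext b
      exact ⟨fun h => ⟨h.1, h.2.2⟩, fun h => ⟨h.1, h.1.trans hlt, h.2⟩⟩
    rw [hset] at hcard
    obtain ⟨ih1, ih2⟩ := ih _ (hρ (ι i, j) (k, j) ⟨Or.inr rfl, hlt⟩) (ι i) j rfl
    obtain ⟨hst1, hst2⟩ := (hS.step_iff i j).1 hSi
    have ih2 := ih2 i rfl
    simp only [← hgap] at hst1 hst2
    rw [hcard]
    by_cases hS'i : S' (ι i) j
    · calc _ ≤ {k' | gap p' q k' j < gap p' q (ι i) j ∧ S' k' j}.encard + 1 := by gcongr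
        _ = (insert (ι i) {k' | gap p' q k' j < gap p' q (ι i) j ∧ S' k' j}).encard :=
          (Set.encard_insert_of_notMem (by simp)).symm
        _ ≤ _ := by
          refine Set.encard_le_encard (Set.insert_subset ⟨hlt, hS'i⟩ fun k' h => ?_)
          exact ⟨h.1.trans hlt, h.2⟩
    · have h1 : ¬ Step p' q S' (ι i) j := fun h => hS'i ((hS'.step_iff _ _).2 h)
      rw [Step, not_and_or, not_lt, not_lt] at h1
      rcases h1 with h1 | h1
      · rw [hp] at h1
        exact absurd (h1.trans ih2) (not_le.2 hst1)
      · refine (Order.add_one_le_of_lt hst2).trans (h1.trans ?_)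
        exact Set.encard_le_encard fun k' h => ⟨h.1.trans hlt, h.2⟩
  · rintro i rfl
    rcases Set.eq_empty_or_nonempty
      {j' | gap p' q (ι i) j' < gap p' q (ι i) j ∧ S' (ι i) j'} with he | hne
    · rw [he]; simp
    obtain ⟨l, ⟨hlt, hSl⟩, hcard⟩ := exists_encard_eq_add_one
      ((Set.finite_of_encard_eq_coe (hS'.degree_red (ι i))).subset (fun i hi => hi.2)) hne
      (f := fun j => gap p' q (ι i) j) (fun a b h => hties.red _ _ _ h)
    have hset : {b | gap p' q (ι i) b < gap p' q (ι i) l ∧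
        b ∈ {j' | gap p' q (ι i) j' < gap p' q (ι i) j ∧ S' (ι i) j'}} =
        {b | gap p' q (ι i) b < gap p' q (ι i) l ∧ S' (ι i) b} := by
      ext b
      exact ⟨fun h => ⟨h.1, h.2.2⟩, fun h => ⟨h.1, h.1.trans hlt, h.2⟩⟩
    rw [hset] at hcard
    obtain ⟨ih1, ih2⟩ := ih _ (hρ (ι i, l) (ι i, j) ⟨Or.inl rfl, hlt⟩) (ι i) l rfl
    obtain ⟨hst1, hst2⟩ := (hS'.step_iff _ _).1 hSl
    have ih2 := ih2 i rfl
    rw [hcard]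
    by_cases hSi : S i l
    · calc _ ≤ {j' | gap p' q (ι i) j' < gap p' q (ι i) l ∧ S i j'}.encard + 1 := by gcongr
        _ = (insert l {j' | gap p' q (ι i) j' < gap p' q (ι i) l ∧ S i j'}).encard :=
          (Set.encard_insert_of_notMem (by simp)).symm
        _ ≤ _ := by
          refine Set.encard_le_encard (Set.insert_subset ⟨hlt, hSi⟩ fun k' h => ?_)
          exact ⟨h.1.trans hlt, h.2⟩
    · have h1 : ¬ Step p q S i l := fun h => hSi ((hS.step_iff _ _).2 h)
      rw [Step, not_and_or, not_lt, not_lt] at h1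
      simp only [← hgap] at h1
      rcases h1 with h1 | h1
      · rw [hp] at hst1
        refine (Order.add_one_le_of_lt hst1).trans (h1.trans ?_)
        exact Set.encard_le_encard fun k' h => ⟨h.1.trans hlt, h.2⟩
      · exact absurd (h1.trans ih1) (not_le.2 hst2)

/-- In the matching with additional red points, such a point is only matched to blue points that
desired its position before. -/
theorem desiresIn_of_extension (hι : Function.Injective ι) (hp : ∀ i, p' (ι i) = p i)
    (hties : NoTies p' q) {ρ : ℕ × ℕ → ℕ} (hρ : ∀ e' e, Prec p' q e' e → ρ e' < ρ e)
    (hS : IsPerfect p q S) (hS' : IsPerfect p' q S') {k j : ℕ} (hk : k ∉ Set.range ι)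
    (hkj : S' k j) : DesiresIn p q S (p' k).1 j := by
  have hgap : ∀ i j, gap p' q (ι i) j = gap p q i j := fun i j => by rw [gap, gap, hp]
  by_contra hno
  have h1 : {i | gap p' q (ι i) j < gap p' q k j ∧ S i j} = {i | S i j} := by
    ext i
    refine ⟨fun h => h.2, fun h => ⟨?_, h⟩⟩
    have h2 : ¬ |(q j).1 - (p' k).1| < gap p q i j := fun h3 => hno ⟨i, h, h3⟩
    rw [abs_sub_comm, ← hgap, not_lt] at h2
    exact lt_of_le_of_ne h2 fun h3 => hk ⟨i, hties.blue _ _ _ h3⟩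
  have h2 := (encard_le_of_extension hι hp hties hρ hS hS' k j).1
  rw [h1, hS.degree_blue] at h2
  exact absurd h2 (not_le.2 ((hS'.step_iff _ _).1 hkj).2)

/-- If the ends of `[a, b]` are desired by finitely many blue points only, so is the whole interval,
since a far blue point that desires a point of `[a, b]` desires the end next to it. -/
theorem finite_desiresIn_Icc (hq : LocFin q) {a b : ℝ}
    (ha : {j | DesiresIn p q S a j}.Finite) (hb : {j | DesiresIn p q S b j}.Finite) :
    {j | ∃ z ∈ Set.Icc a b, DesiresIn p q S z j}.Finite := by
  refine ((ha.union hb).union (hq.finite_Icc a b)).subset ?_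
  rintro j ⟨z, ⟨hz1, hz2⟩, i, hij, hlt⟩
  rcases lt_or_ge (q j).1 a with h | h
  · refine Or.inl (Or.inl ⟨i, hij, lt_of_le_of_lt ?_ hlt⟩)
    rw [abs_of_nonpos (by linarith), abs_of_nonpos (by linarith)]
    linarith
  rcases le_or_gt (q j).1 b with h' | h'
  · exact Or.inr ⟨h, h'⟩
  · refine Or.inl (Or.inr ⟨i, hij, lt_of_le_of_lt ?_ hlt⟩)
    rw [abs_of_nonneg (by linarith), abs_of_nonneg (by linarith)]
    linarith

end Monotone

/-- If only finitely many blue points desire the ends of `[a, b]`, then at most a bounded number of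
red points can be added in `[a, b]` without destroying the existence of a perfect stable matching:
every added point occupies a stub of one of the blue points that desire `[a, b]`. -/
theorem exists_no_perfect_extension {p q : ℕ → ℝ × ℕ} {S : ℕ → ℕ → Prop} (hpf : LocFin p)
    (hq : LocFin q) (hg : HasGaps q) (hS : IsPerfect p q S) {a b : ℝ}
    (ha : {j | DesiresIn p q S a j}.Finite) (hb : {j | DesiresIn p q S b j}.Finite) :
    ∃ K : ℕ, ∀ (p' : ℕ → ℝ × ℕ) (S' : ℕ → ℕ → Prop), NoTies p' q → IsPerfect p' q S' →
      (∀ n, p' (n + K) = p n) → (∀ n < K, (p' n).1 ∈ Set.Icc a b ∧ 1 ≤ (p' n).2) → False := by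
  have hfin := finite_desiresIn_Icc hq ha hb
  set F := hfin.toFinset with hF
  refine ⟨(∑ j ∈ F, (q j).2) + 1, fun p' S' hties hS' hext hnew => ?_⟩
  set K := (∑ j ∈ F, (q j).2) + 1 with hK
  have hpf' : LocFin p' := by
    intro L
    refine ((Set.finite_Iio K).union ((hpf L).image (· + K))).subset fun n hn => ?_
    rcases lt_or_ge n K with h | h
    · exact Or.inl h
    · refine Or.inr ⟨n - K, ?_, by simp only; omega⟩
      have := hext (n - K)
      rw [Nat.sub_add_cancel h] at this
      simpa [this] using hn
  obtain ⟨ρ, hρ⟩ := exists_rank hpf' hq hg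
  have hsub : (Set.Iio K) ⊆ ⋃ j ∈ F, {k | S' k j} := by
    intro k hk
    obtain ⟨j, hj⟩ : {j | S' k j}.Nonempty := by
      rw [← Set.encard_ne_zero, hS'.degree_red]
      have := (hnew k hk).2
      exact_mod_cast (by omega : (p' k).2 ≠ 0)
    have hd := desiresIn_of_extension (ι := (· + K)) (add_left_injective K) hext hties hρ hS hS'
      (by rintro ⟨n, rfl⟩; simp at hk) hj
    simp only [Set.mem_iUnion]
    exact ⟨j, by rw [hF, Set.Finite.mem_toFinset]; exact ⟨_, (hnew k hk).1, hd⟩, hj⟩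
  have hle : (Set.Iio K).encard ≤ ∑ j ∈ F, ((q j).2 : ℕ∞) := by
    refine (Set.encard_le_encard hsub).trans ?_
    clear hsub hnew hext
    clear_value K
    clear hK
    clear_value F
    clear hF
    induction F using Finset.induction_on with
    | empty => simp
    | insert j F hj ih =>
      rw [Finset.set_biUnion_insert, Finset.sum_insert hj, ← hS'.degree_blue j]
      exact (Set.encard_union_le _ _).trans (by gcongr)
  rw [← Nat.cast_sum] at hle
  have h3 : (Set.Iio K).encard = K := by
    rw [← Finset.coe_range, Set.encard_coe_eq_coe_finsetCard, Finset.card_range]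
  rw [h3] at hle
  have : K ≤ ∑ j ∈ F, (q j).2 := by exact_mod_cast hle
  omega

/-! ### Transfer to matchings of sets of points -/

/-- A stable multi-matching of the real line is, in terms of indices, a fixed point of `Step`. -/
theorem IsStableMultiMatching.isPerfect {p q : ℕ → ℝ × ℕ} {G : SimpleGraph ℝ}
    (hG : IsStableMultiMatching (fun i => (p i).1) (fun i => (p i).2) (fun j => (q j).1)
      (fun j => (q j).2) G)
    (hties : NoTies p q) (hne : ∀ i j, (p i).1 ≠ (q j).1) :
    IsPerfect p q (fun i j => G.Adj (p i).1 (q j).1) := by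
  have hinjp : Function.Injective fun i => (p i).1 := fun i i' h =>
    hties.blue i i' 0 (by simp only [gap]; rw [show (p i).1 = (p i').1 from h])
  have hinjq : Function.Injective fun i => (q i).1 := fun j j' h =>
    hties.red 0 j j' (by simp only [gap]; rw [show (q j).1 = (q j').1 from h])
  have hdr : ∀ i, {j | G.Adj (p i).1 (q j).1}.encard = (p i).2 := by
    intro i
    rw [← hG.degree_red i, ← hinjq.encard_image]
    congr 1
    ext z
    constructor
    · rintro ⟨j, hj, rfl⟩; exact hj
    · intro hz
      rcases hG.bipartite _ _ hz with ⟨-, ⟨j, rfl⟩⟩ | ⟨⟨j, hj⟩, -⟩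
      · exact ⟨j, hz, rfl⟩
      · exact absurd hj.symm (hne i j)
  have hdb : ∀ j, {i | G.Adj (p i).1 (q j).1}.encard = (q j).2 := by
    intro j
    rw [← hG.degree_blue j, ← hinjp.encard_image]
    congr 1
    ext z
    constructor
    · rintro ⟨i, hi, rfl⟩; exact G.adj_symm hi
    · intro hz
      rcases hG.bipartite _ _ hz with ⟨⟨i, hi⟩, -⟩ | ⟨-, ⟨i, rfl⟩⟩
      · exact absurd hi (hne i j)
      · exact ⟨i, G.adj_symm hz, rfl⟩
  refine ⟨fun i j => ⟨fun h => ⟨?_, ?_⟩, fun h => ?_⟩, hdr, hdb⟩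
  · rw [← hdr]
    refine ((Set.finite_of_encard_eq_coe (hdr i)).subset fun _ h' => h'.2).encard_lt_encard
      ⟨fun _ h' => h'.2, fun hs => ?_⟩
    exact lt_irrefl _ (hs h).1
  · rw [← hdb]
    refine ((Set.finite_of_encard_eq_coe (hdb j)).subset fun _ h' => h'.2).encard_lt_encard
      ⟨fun _ h' => h'.2, fun hs => ?_⟩
    exact lt_irrefl _ (hs h).1
  · rcases hG.stable _ ⟨i, rfl⟩ _ ⟨j, rfl⟩ (hne i j) with h' | h' | h'
    · exact h'
    · by_contra hno
      refine absurd h.1 (not_lt.2 ?_)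
      rw [← hdr]
      refine Set.encard_le_encard fun j' hj' => ⟨lt_of_le_of_ne (h' _ hj') fun he => ?_, hj'⟩
      rw [hties.red i j' j he] at hj'
      exact hno hj'
    · by_contra hno
      refine absurd h.2 (not_lt.2 ?_)
      rw [← hdb]
      refine Set.encard_le_encard fun i' hi' => ⟨lt_of_le_of_ne ?_ fun he => ?_, hi'⟩
      · have := h' _ (G.adj_symm hi')
        rw [abs_sub_comm] at this
        exact this
      · rw [hties.blue i' i j he] at hi'
        exact hno hi'

/-- A blue point desires `z` in the graph if and only if its index does in the induced matching. -/
theorem desires_iff {p q : ℕ → ℝ × ℕ} {G : SimpleGraph ℝ}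
    (hG : IsStableMultiMatching (fun i => (p i).1) (fun i => (p i).2) (fun j => (q j).1)
      (fun j => (q j).2) G)
    (hne : ∀ i j, (p i).1 ≠ (q j).1) (z : ℝ) (j : ℕ) :
    Desires G (q j).1 z ↔ DesiresIn p q (fun i j => G.Adj (p i).1 (q j).1) z j := by
  simp only [Desires, longestEdge, lt_iSup_iff, DesiresIn, gap]
  constructor
  · rintro ⟨x, hx, hlt⟩
    rcases hG.bipartite _ _ hx with ⟨⟨i, hi⟩, -⟩ | ⟨-, ⟨i, rfl⟩⟩
    · exact absurd hi (hne i j)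
    · refine ⟨i, G.adj_symm hx, ?_⟩
      rw [abs_sub_comm (p i).1]
      exact (ENNReal.ofReal_lt_ofReal_iff_of_nonneg (abs_nonneg _)).1 hlt
  · rintro ⟨i, hi, hlt⟩
    refine ⟨(p i).1, G.adj_symm hi, ?_⟩
    rw [abs_sub_comm (p i).1] at hlt
    exact (ENNReal.ofReal_lt_ofReal_iff_of_nonneg (abs_nonneg _)).2 hlt

/-! ### Finite-dimensional laws of a Poisson process -/

theorem countingMeasure_apply (x : ℕ → ℝ) {A : Set ℝ} (hA : MeasurableSet A) :
    countingMeasure x A = ∑' i, A.indicator 1 (x i) := by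
  rw [countingMeasure, Measure.sum_apply _ hA]
  exact tsum_congr fun i => Measure.dirac_apply' _ hA

theorem countingMeasure_eq_encard (x : ℕ → ℝ) {A : Set ℝ} (hA : MeasurableSet A) :
    countingMeasure x A = ((x ⁻¹' A).encard : ℝ≥0∞) := by
  rw [countingMeasure_apply x hA, ← ENNReal.tsum_set_one, tsum_subtype (x ⁻¹' A) (fun _ => 1)]
  rfl

/-- The sequence with first term `a` followed by the terms of `s`. -/
def cons {α : Type*} (a : α) (s : ℕ → α) : ℕ → α
  | 0 => a
  | n + 1 => s n

theorem countingMeasure_cons (a : ℝ) (t : ℕ → ℝ) {A : Set ℝ} (hA : MeasurableSet A) :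
    countingMeasure (cons a t) A = countingMeasure t A + A.indicator 1 a := by
  rw [countingMeasure_apply _ hA, countingMeasure_apply _ hA, tsum_eq_zero_add' ENNReal.summable,
    add_comm]
  rfl

theorem measurable_countingMeasure {A : Set ℝ} (hA : MeasurableSet A) :
    Measurable fun t : ℕ → ℝ => countingMeasure t A := by
  simp_rw [countingMeasure_apply _ hA]
  have h : Measurable (A.indicator (1 : ℝ → ℝ≥0∞)) := measurable_one.indicator hA
  exact Measurable.tsum fun i => h.comp (measurable_pi_apply i)

/-- The recursion `(n + 1) P(n + 1) = c P(n)` of the Poisson weights. -/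
theorem succ_mul_poissonMeasure (c : ℝ≥0) (n : ℕ) :
    ((n + 1 : ℕ) : ℝ≥0∞) * poissonMeasure c {n + 1} = c * poissonMeasure c {n} := by
  rw [poissonMeasure_singleton, poissonMeasure_singleton, ← ENNReal.ofReal_natCast,
    ← ENNReal.ofReal_mul (by positivity), ← ENNReal.ofReal_coe_nnreal,
    ← ENNReal.ofReal_mul (by positivity)]
  congr 1
  rw [Nat.factorial_succ]
  push_cast
  field_simp
  ring

/-- The Poisson identity `E[k F(k)] = c E[F(k + 1)]` in one coordinate of a vector of independent
Poisson variables. -/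
theorem lintegral_mul_pi_poissonMeasure {I : Type*} [Fintype I] [DecidableEq I] (c : I → ℝ≥0)
    (s : I) (F : (I → ℕ) → ℝ≥0∞) :
    ∫⁻ k, k s * F k ∂Measure.pi (fun i => poissonMeasure (c i)) =
      c s * ∫⁻ k, F (k + Pi.single s 1) ∂Measure.pi (fun i => poissonMeasure (c i)) := by
  rw [lintegral_countable', lintegral_countable', ← ENNReal.tsum_mul_left]
  have hinj : Function.Injective fun k : I → ℕ => k + Pi.single s 1 := add_left_injective _
  rw [← hinj.tsum_eq]
  · refine tsum_congr fun k => ?_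
    simp only [Measure.pi_singleton]
    rw [← Finset.mul_prod_erase _ _ (Finset.mem_univ s),
      ← Finset.mul_prod_erase _ (fun i => poissonMeasure (c i) {k i}) (Finset.mem_univ s)]
    have h1 : ∏ i ∈ Finset.univ.erase s, poissonMeasure (c i) {(k + Pi.single s 1 : I → ℕ) i} =
        ∏ i ∈ Finset.univ.erase s, poissonMeasure (c i) {k i} := by
      refine Finset.prod_congr rfl fun i hi => ?_
      simp [Finset.ne_of_mem_erase hi]
    rw [h1]
    have h2 := succ_mul_poissonMeasure (c s) (k s)
    simp only [Pi.add_apply, Pi.single_eq_same]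
    calc _ = (((k s + 1 : ℕ) : ℝ≥0∞) * poissonMeasure (c s) {k s + 1}) *
          F (k + Pi.single s 1) * ∏ i ∈ Finset.univ.erase s, poissonMeasure (c i) {k i} := by ring
      _ = _ := by rw [h2]; ring
  · intro k hk
    have hks : k s ≠ 0 := by
      rintro h
      simp [h] at hk
    refine ⟨k - Pi.single s 1, ?_⟩
    ext i
    by_cases h : i = s
    · subst h; simp; omega
    · simp [h]

/-- The atom with code `s` of the algebra generated by the sets `A j`: the points that lie in `A j`
precisely for `j ∈ s`. -/
def atom {J : Type*} (A : J → Set ℝ) (s : Finset J) : Set ℝ := {x | ∀ j, x ∈ A j ↔ j ∈ s}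

section Atoms

variable {J : Type*} {A : J → Set ℝ}

theorem disjoint_atom {s s' : Finset J} (h : s ≠ s') : Disjoint (atom A s) (atom A s') := by
  rw [Set.disjoint_left]
  intro x hx hx'
  exact h (Finset.ext fun j => (hx j).symm.trans (hx' j))

theorem atom_subset {s : Finset J} {j : J} (hj : j ∈ s) : atom A s ⊆ A j := fun _ hx => (hx j).2 hj

variable [Fintype J] [DecidableEq J]

theorem measurableSet_atom (hA : ∀ j, MeasurableSet (A j)) (s : Finset J) :
    MeasurableSet (atom A s) := by
  have : atom A s = ⋂ j, {x | x ∈ A j ↔ j ∈ s} := by ext; simp [atom]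
  rw [this]
  refine MeasurableSet.iInter fun j => ?_
  by_cases h : j ∈ s
  · simpa [h] using hA j
  · simp only [h, iff_false]
    exact (hA j).compl

theorem eq_biUnion_atom (j : J) :
    A j = ⋃ s ∈ Finset.univ.filter (fun s : {s : Finset J // s.Nonempty} => j ∈ s.1),
      atom A s.1 := by
  classical
  ext x
  simp only [Set.mem_iUnion, Finset.mem_filter, Finset.mem_univ, true_and]
  constructor
  · intro hx
    refine ⟨⟨Finset.univ.filter fun j => x ∈ A j, ⟨j, by simpa using hx⟩⟩, by simpa using hx, ?_⟩
    intro j'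
    simp
  · rintro ⟨s, hs, hx⟩
    exact (hx j).2 hs

/-- Recovers the masses of sets from the masses of their atoms. -/
noncomputable def sumAtoms (v : {s : Finset J // s.Nonempty} → ℝ≥0∞) (j : J) : ℝ≥0∞ :=
  ∑ s ∈ Finset.univ.filter (fun s : {s : Finset J // s.Nonempty} => j ∈ s.1), v s

theorem measurable_sumAtoms : Measurable (sumAtoms (J := J)) := by
  unfold sumAtoms
  fun_prop

theorem sumAtoms_measure (hA : ∀ j, MeasurableSet (A j)) (m : Measure ℝ) :
    sumAtoms (fun s : {s : Finset J // s.Nonempty} => m (atom A s.1)) = fun j => m (A j) := by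
  ext j
  rw [sumAtoms]
  conv_rhs => rw [eq_biUnion_atom (A := A) j]
  rw [measure_biUnion_finset]
  · intro s _ s' _ h
    exact disjoint_atom fun h' => h (Subtype.ext h')
  · exact fun s _ => measurableSet_atom hA _

end Atoms

section FiniteDimensional

variable {Ω : Type*} [MeasurableSpace Ω] {P : Measure Ω} {lam : ℝ≥0}
  {T : ℕ → Ω → ℝ} {J : Type*} [Fintype J] [DecidableEq J] {A : J → Set ℝ}

theorem IsPoissonProcess.measurable (hT : IsPoissonProcess P lam T) :
    Measurable fun ω i => T i ω := measurable_pi_iff.2 hT.measurable_point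

theorem IsPoissonProcess.measurable_count (hT : IsPoissonProcess P lam T) {A : Set ℝ}
    (hA : MeasurableSet A) : Measurable fun ω => countingMeasure (fun i => T i ω) A :=
  (measurable_countingMeasure hA).comp hT.measurable

/-- The counts of a Poisson process in the atoms are independent Poisson variables. -/
theorem IsPoissonProcess.map_atoms [IsProbabilityMeasure P] (hT : IsPoissonProcess P lam T)
    (hA : ∀ j, MeasurableSet (A j)) (hfin : ∀ j, volume (A j) ≠ ∞) :
    P.map (fun ω (s : {s : Finset J // s.Nonempty}) =>
        countingMeasure (fun i => T i ω) (atom A s.1)) =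
      (Measure.pi fun s : {s : Finset J // s.Nonempty} =>
        poissonMeasure (lam * (volume (atom A s.1)).toNNReal)).map fun k s => (k s : ℝ≥0∞) := by
  have hind : iIndepFun (fun (s : {s : Finset J // s.Nonempty}) ω =>
      countingMeasure (fun i => T i ω) (atom A s.1)) P := by
    let e := Fintype.equivFin {s : Finset J // s.Nonempty}
    have h := hT.indep_count _ (fun i => atom A (e.symm i).1)
      (fun i => measurableSet_atom hA _)
      (fun i i' h => disjoint_atom fun h' => h (e.symm.injective (Subtype.ext h')))
    have h2 := h.precomp e.injective
    simpa using h2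
  rw [iIndepFun_iff_map_fun_eq_pi_map
    (fun s => (hT.measurable_count (measurableSet_atom hA _)).aemeasurable)] at hind
  rw [hind]
  rw [Measure.pi_map_pi (fun s => (measurable_of_countable _).aemeasurable)]
  congr 1
  ext1 s
  obtain ⟨j, hj⟩ := s.2
  exact (hT.hasLaw_count _ (measurableSet_atom hA _)
    (measure_ne_top_of_subset (atom_subset hj) (hfin j))).map_eq

/-- Expectations of functions of finitely many counts, expressed through the counts in the atoms. The
function takes the vector of counts twice, so that one copy can be treated as a parameter. -/
theorem IsPoissonProcess.lintegral_atoms [IsProbabilityMeasure P] (hT : IsPoissonProcess P lam T)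
    (hA : ∀ j, MeasurableSet (A j)) (hfin : ∀ j, volume (A j) ≠ ∞)
    {f : (J → ℝ≥0∞) → (J → ℝ≥0∞) → ℝ≥0∞} (hf : Measurable fun v => f v v) :
    ∫⁻ ω, f (fun j => countingMeasure (fun i => T i ω) (A j))
        (fun j => countingMeasure (fun i => T i ω) (A j)) ∂P =
      ∫⁻ k, f (sumAtoms fun s => (k s : ℝ≥0∞)) (sumAtoms fun s => (k s : ℝ≥0∞))
        ∂Measure.pi fun s : {s : Finset J // s.Nonempty} =>
          poissonMeasure (lam * (volume (atom A s.1)).toNNReal) := by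
  have hm : Measurable fun v : {s : Finset J // s.Nonempty} → ℝ≥0∞ =>
    f (sumAtoms v) (sumAtoms v) := hf.comp measurable_sumAtoms
  calc _ = ∫⁻ ω, (fun v => f (sumAtoms v) (sumAtoms v))
        (fun s : {s : Finset J // s.Nonempty} =>
          countingMeasure (fun i => T i ω) (atom A s.1)) ∂P := by
        refine lintegral_congr fun ω => ?_
        simp only [sumAtoms_measure hA]
    _ = _ := by
        rw [← lintegral_map hm (measurable_pi_iff.2 fun s =>
          hT.measurable_count (measurableSet_atom hA _)), hT.map_atoms hA hfin,
          lintegral_map hm (measurable_of_countable _)]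

/-- The Mecke equation for functions of finitely many counts. -/
theorem IsPoissonProcess.mecke_finite [IsProbabilityMeasure P] (hT : IsPoissonProcess P lam T)
    (hA : ∀ j, MeasurableSet (A j)) (hfin : ∀ j, volume (A j) ≠ ∞) (j₀ : J)
    {f : (J → ℝ≥0∞) → ℝ≥0∞} (hf : Measurable f) :
    ∫⁻ ω, countingMeasure (fun i => T i ω) (A j₀) *
        f (fun j => countingMeasure (fun i => T i ω) (A j)) ∂P =
      lam * ∫⁻ x in A j₀, ∫⁻ ω,
        f (fun j => countingMeasure (fun i => T i ω) (A j) + (A j).indicator 1 x) ∂P := by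
  have h1 := hT.lintegral_atoms hA hfin (f := fun u v => u j₀ * f v)
    ((measurable_pi_apply j₀).mul hf)
  rw [h1]
  have h2 : ∀ x, ∫⁻ ω, f (fun j => countingMeasure (fun i => T i ω) (A j) +
      (A j).indicator 1 x) ∂P = _ := fun x => hT.lintegral_atoms hA hfin
        (f := fun u _ => f (fun j => u j + (A j).indicator 1 x)) (hf.comp (by fun_prop))
  simp_rw [h2]
  -- Both sides split over the atoms contained in `A j₀`; on each atom the added point increases the
  -- same counts, so the one-coordinate Poisson identity applies.
  conv_rhs => rw [eq_biUnion_atom (A := A) j₀]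
  rw [lintegral_biUnion_finset]
  rotate_left
  · intro s _ s' _ h
    exact disjoint_atom fun h' => h (Subtype.ext h')
  · exact fun s _ => measurableSet_atom hA _
  conv_lhs =>
    enter [2, k]
    rw [sumAtoms, Finset.sum_mul]
  rw [lintegral_finsetSum _ (fun s _ => measurable_of_countable _), Finset.mul_sum]
  refine Finset.sum_congr rfl fun s hs => ?_
  rw [lintegral_mul_pi_poissonMeasure _ s
    (fun k => f (sumAtoms fun s => (k s : ℝ≥0∞)))]
  have h3 : ∀ x ∈ atom A s.1, ∫⁻ k, f (fun j => sumAtoms (fun s => (k s : ℝ≥0∞)) j +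
      (A j).indicator 1 x) ∂(Measure.pi fun s : {s : Finset J // s.Nonempty} =>
          poissonMeasure (lam * (volume (atom A s.1)).toNNReal)) =
      ∫⁻ k, f (sumAtoms fun s' => (((k + Pi.single s 1 : {s : Finset J // s.Nonempty} → ℕ) s' : ℕ) : ℝ≥0∞))
        ∂(Measure.pi fun s : {s : Finset J // s.Nonempty} =>
          poissonMeasure (lam * (volume (atom A s.1)).toNNReal)) := by
    intro x hx
    refine lintegral_congr fun k => ?_
    congr 1
    ext j
    simp only [sumAtoms, Pi.add_apply, Nat.cast_add, Finset.sum_add_distrib]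
    congr 1
    by_cases hj : j ∈ s.1
    · rw [Set.indicator_of_mem ((hx j).2 hj), Finset.sum_eq_single s]
      · simp
      · intro b _ hb; simp [hb]
      · intro h; simp [hj] at h
    · rw [Set.indicator_of_notMem (fun h => hj ((hx j).1 h))]
      refine (Finset.sum_eq_zero fun b hb => ?_).symm
      have : b ≠ s := by rintro rfl; simp [hj] at hb
      simp [this]
  rw [setLIntegral_congr_fun (measurableSet_atom hA _) h3, setLIntegral_const, mul_comm _ (volume _),
    ← mul_assoc]
  congr 1
  rw [ENNReal.coe_mul, ENNReal.coe_toNNReal]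
  simp only [Finset.mem_filter, Finset.mem_univ, true_and] at hs
  exact measure_ne_top_of_subset (atom_subset hs) (hfin _)

end FiniteDimensional

/-! ### The law of the counts in a family of sets -/

/-- The numbers of points of `t` in the sets of a family. -/
noncomputable def countVec {κ : Type*} (A : κ → Set ℝ) (t : ℕ → ℝ) (a : κ) : ℝ≥0∞ :=
  countingMeasure t (A a)

theorem measurable_countVec {κ : Type*} {A : κ → Set ℝ} (hA : ∀ a, MeasurableSet (A a)) :
    Measurable (countVec A) := measurable_pi_iff.2 fun a => measurable_countingMeasure (hA a)

/-- Finite measures on a product of copies of `ℝ≥0∞` are determined by their finite-dimensional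
marginals. -/
theorem measure_pi_ext {κ : Type*} {m m' : Measure (κ → ℝ≥0∞)} [IsFiniteMeasure m]
    (h : ∀ J : Finset κ, m.map J.restrict = m'.map J.restrict) : m = m' :=
  IsProjectiveLimit.unique (P := fun J : Finset κ => m.map J.restrict) (fun _ => rfl)
    fun J => (h J).symm

section Counts

variable {Ω Ω' : Type*} [MeasurableSpace Ω] [MeasurableSpace Ω'] {P : Measure Ω} {P' : Measure Ω'}
  [IsProbabilityMeasure P] [IsProbabilityMeasure P'] {lam : ℝ≥0} {T : ℕ → Ω → ℝ} {T' : ℕ → Ω' → ℝ}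
  {κ : Type*} {A : κ → Set ℝ}

theorem IsPoissonProcess.map_countVec_eq (hT : IsPoissonProcess P lam T)
    (hT' : IsPoissonProcess P' lam T') (hA : ∀ a, MeasurableSet (A a))
    (hfin : ∀ a, volume (A a) ≠ ∞) :
    P.map (fun ω => countVec A fun i => T i ω) = P'.map (fun ω => countVec A fun i => T' i ω) := by
  classical
  have hm : Measurable fun ω => countVec A fun i => T i ω :=
    (measurable_countVec hA).comp hT.measurable
  have hm' : Measurable fun ω => countVec A fun i => T' i ω :=
    (measurable_countVec hA).comp hT'.measurable
  have : IsProbabilityMeasure (P.map (fun ω => countVec A fun i => T i ω)) :=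
    Measure.isProbabilityMeasure_map hm.aemeasurable
  refine measure_pi_ext fun J => ?_
  rw [Measure.map_map (by fun_prop) hm, Measure.map_map (by fun_prop) hm']
  refine Measure.ext fun S hS => ?_
  have h1 := hT.lintegral_atoms (A := fun j : J => A j) (fun j => hA j) (fun j => hfin j)
    (f := fun v _ => S.indicator 1 v) (measurable_one.indicator hS)
  have h2 := hT'.lintegral_atoms (A := fun j : J => A j) (fun j => hA j) (fun j => hfin j)
    (f := fun v _ => S.indicator 1 v) (measurable_one.indicator hS)
  rw [← lintegral_indicator_one hS, ← lintegral_indicator_one hS,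
    lintegral_map (measurable_one.indicator hS) ((Finset.measurable_restrict J).comp hm),
    lintegral_map (measurable_one.indicator hS) ((Finset.measurable_restrict J).comp hm')]
  exact h1.trans h2.symm

/-- The Mecke equation for events that depend on the counts in a family of sets. -/
theorem IsPoissonProcess.mecke (hT : IsPoissonProcess P lam T) (hA : ∀ a, MeasurableSet (A a))
    (hfin : ∀ a, volume (A a) ≠ ∞) (a₀ : κ) :
    (P.withDensity fun ω => countingMeasure (fun i => T i ω) (A a₀)).map
        (fun ω => countVec A fun i => T i ω) =
      (lam • ((volume.restrict (A a₀)).prod P)).map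
        (fun y a => countVec A (fun i => T i y.2) a + (A a).indicator 1 y.1) := by
  classical
  have hm : Measurable fun ω => countVec A fun i => T i ω :=
    (measurable_countVec hA).comp hT.measurable
  have hm1 : Measurable fun (y : ℝ × Ω) a =>
      countVec A (fun i => T i y.2) a + (A a).indicator (1 : ℝ → ℝ≥0∞) y.1 := by
    refine measurable_pi_iff.2 fun a => ?_
    exact (((measurable_pi_apply a).comp hm).comp measurable_snd).add
      ((measurable_one.indicator (hA a)).comp measurable_fst)
  have hm0 := hT.measurable_count (hA a₀)
  have hfinite : ∫⁻ ω, countingMeasure (fun i => T i ω) (A a₀) ∂P ≠ ∞ := by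
    have := hT.mecke_finite (A := fun _ : Unit => A a₀) (fun _ => hA a₀) (fun _ => hfin a₀) ()
      (f := fun _ => 1) measurable_const
    simp only [mul_one, lintegral_const, measure_univ, one_mul, Measure.restrict_apply_univ] at this
    rw [this]
    exact ENNReal.mul_ne_top ENNReal.coe_ne_top (hfin a₀)
  have : IsFiniteMeasure (P.withDensity fun ω => countingMeasure (fun i => T i ω) (A a₀)) :=
    isFiniteMeasure_withDensity hfinite
  refine measure_pi_ext fun J => ?_
  rw [Measure.map_map (by fun_prop) hm, Measure.map_map (by fun_prop) hm1]
  refine Measure.ext fun S hS => ?_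
  have hS1 : Measurable (S.indicator (1 : (J → ℝ≥0∞) → ℝ≥0∞)) := measurable_one.indicator hS
  -- The index `none` stands for the set `A a₀` that weights the measure.
  have h1 := hT.mecke_finite (A := fun j : Option J => j.elim (A a₀) fun j => A j)
    (by rintro (_ | j) <;> [exact hA a₀; exact hA j])
    (by rintro (_ | j) <;> [exact hfin a₀; exact hfin j]) none
    (f := fun v => S.indicator 1 fun j => v (some j)) (hS1.comp (by fun_prop))
  rw [← lintegral_indicator_one hS, ← lintegral_indicator_one hS,
    lintegral_map hS1 ((Finset.measurable_restrict J).comp hm),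
    lintegral_map hS1 ((Finset.measurable_restrict J).comp hm1),
    lintegral_smul_measure]
  have e1 := lintegral_withDensity_eq_lintegral_mul P hm0
    (hS1.comp ((Finset.measurable_restrict J).comp hm))
  have e2 := lintegral_prod (μ := volume.restrict (A a₀)) (ν := P) _
    (hS1.comp ((Finset.measurable_restrict J).comp hm1)).aemeasurable
  exact e1.trans (h1.trans (congrArg (lam • ·) e2.symm))

end Counts

/-! ### Recovering the points from the counts -/

/-- A set of reals that is unbounded above and has finitely many elements below each bound is the
range of a strictly increasing sequence. -/
theorem exists_strictMono_range_eq {s : Set ℝ} (hinf : ∀ L, ∃ x ∈ s, L < x)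
    (hfin : ∀ L, (s ∩ Set.Iic L).Finite) : ∃ v : ℕ → ℝ, StrictMono v ∧ Set.range v = s := by
  classical
  let _ : LocallyFiniteOrder s := LocallyFiniteOrder.ofFiniteIcc fun a b => by
    refine Set.Finite.of_finite_image ((hfin b).subset ?_) Subtype.val_injective.injOn
    rintro _ ⟨x, hx, rfl⟩
    exact ⟨x.2, hx.2⟩
  let _ : SuccOrder s := LinearLocallyFiniteOrder.succOrder s
  let _ : PredOrder s := LinearLocallyFiniteOrder.predOrder s
  have : NoMaxOrder s := ⟨fun a => by
    obtain ⟨x, hx, h⟩ := hinf a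
    exact ⟨⟨x, hx⟩, h⟩⟩
  obtain ⟨x, hx, -⟩ := hinf 0
  obtain ⟨b, hb, hmin⟩ := Set.exists_min_image _ id (hfin x) ⟨x, hx, Set.mem_Iic.2 le_rfl⟩
  have hbot : ∀ a : s, (⟨b, hb.1⟩ : s) ≤ a := fun a => by
    rcases le_total a.1 x with h | h
    · exact hmin a ⟨a.2, h⟩
    · exact (hmin x ⟨hx, Set.mem_Iic.2 le_rfl⟩).trans h
  let _ : OrderBot s := { bot := ⟨b, hb.1⟩, bot_le := hbot }
  let e := (orderIsoNatOfLinearSuccPredArch (ι := s)).symm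
  refine ⟨fun n => e n, fun a b h => e.strictMono h, ?_⟩
  ext y
  constructor
  · rintro ⟨n, rfl⟩; exact (e n).2
  · intro hy
    exact ⟨e.symm ⟨y, hy⟩, by simp⟩

/-- The `n`-th point on the positive half-line, where `c q` is the number of points up to `q`. -/
noncomputable def nthPoint (c : ℚ → ℝ≥0∞) (n : ℕ) : ℝ :=
  (⨅ q : ℚ, if 0 < q ∧ ((n + 1 : ℕ) : ℝ≥0∞) ≤ c q then ENNReal.ofReal q else ∞).toReal

theorem measurable_nthPoint (n : ℕ) : Measurable fun c => nthPoint c n := by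
  refine ENNReal.measurable_toReal.comp (Measurable.iInf fun q => ?_)
  refine Measurable.ite ?_ measurable_const measurable_const
  by_cases hq : 0 < q
  · simp only [hq, true_and]
    exact measurableSet_le measurable_const (measurable_pi_apply q)
  · simp [hq]

theorem natCast_le_encard_iff {v : ℕ → ℝ} (hv : StrictMono v) (x : ℝ) (n : ℕ) :
    ((n + 1 : ℕ) : ℝ≥0∞) ≤ ({m | v m ≤ x}.encard : ℝ≥0∞) ↔ v n ≤ x := by
  have h : ((n + 1 : ℕ) : ℝ≥0∞) = (((n + 1 : ℕ) : ℕ∞) : ℝ≥0∞) := by simp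
  rw [h, ENat.toENNReal_le]
  constructor
  · intro h
    by_contra! hlt
    have h1 : {m | v m ≤ x} ⊆ (Finset.range n : Set ℕ) := fun m hm => by
      simp only [Finset.coe_range, Set.mem_Iio]
      exact hv.lt_iff_lt.1 (lt_of_le_of_lt hm hlt)
    have h2 := h.trans (Set.encard_le_encard h1)
    rw [Set.encard_coe_eq_coe_finsetCard, Finset.card_range] at h2
    have : n + 1 ≤ n := by exact_mod_cast h2
    omega
  · intro h
    have h1 : (Finset.range (n + 1) : Set ℕ) ⊆ {m | v m ≤ x} := fun m hm => by
      simp only [Finset.coe_range, Set.mem_Iio] at hm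
      exact (hv.monotone (by omega)).trans h
    have h2 := Set.encard_le_encard h1
    rwa [Set.encard_coe_eq_coe_finsetCard, Finset.card_range] at h2

theorem nthPoint_eq {v : ℕ → ℝ} (hv : StrictMono v) (h0 : ∀ n, 0 ≤ v n) {c : ℚ → ℝ≥0∞}
    (hc : ∀ q : ℚ, 0 < q → c q = ({m | v m ≤ q}.encard : ℝ≥0∞)) : nthPoint c = v := by
  ext n
  have key : ⨅ q : ℚ, (if 0 < q ∧ ((n + 1 : ℕ) : ℝ≥0∞) ≤ c q then ENNReal.ofReal q else ∞) =
      ENNReal.ofReal (v n) := by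
    apply le_antisymm
    · by_contra! hlt
      obtain ⟨q, hq0, h1, h2⟩ := ENNReal.lt_iff_exists_rat_btwn.1 hlt
      have h1' : v n < q := (ENNReal.ofReal_lt_ofReal_iff_of_nonneg (h0 n)).1 h1
      have hq : 0 < q := by exact_mod_cast (h0 n).trans_lt h1'
      refine not_le.2 h2 ((iInf_le _ q).trans ?_)
      rw [if_pos ⟨hq, by rw [hc q hq, natCast_le_encard_iff hv]; exact h1'.le⟩]
      exact le_rfl
    · refine le_iInf fun q => ?_
      split_ifs with h
      · rw [hc q h.1, natCast_le_encard_iff hv] at h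
        exact ENNReal.ofReal_le_ofReal h.2
      · exact le_top
  rw [nthPoint, key, ENNReal.toReal_ofReal (h0 n)]

/-- The half-open or closed interval between the origin and `q`; the origin counts as positive. -/
def ray (q : ℚ) : Set ℝ := Set.Icc 0 (q : ℝ) ∪ Set.Ico (q : ℝ) 0

theorem measurableSet_ray (q : ℚ) : MeasurableSet (ray q) := measurableSet_Icc.union measurableSet_Ico

theorem volume_ray_ne_top (q : ℚ) : volume (ray q) ≠ ∞ :=
  measure_union_ne_top (by simp) (by simp)

theorem iUnion_ray : ⋃ q, ray q = Set.univ := by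
  refine Set.eq_univ_of_forall fun x => Set.mem_iUnion.2 ?_
  rcases le_or_gt 0 x with h | h
  · obtain ⟨q, hq⟩ := exists_rat_gt x
    exact ⟨q, Or.inl ⟨h, hq.le⟩⟩
  · obtain ⟨q, hq⟩ := exists_rat_lt x
    exact ⟨q, Or.inr ⟨hq.le, h⟩⟩

/-- A canonical enumeration of the points, computed from the counts in the sets `ray q`. -/
noncomputable def decode (c : ℚ → ℝ≥0∞) (m : ℕ) : ℝ :=
  Sum.elim (nthPoint c) (fun n => -nthPoint (fun q => c (-q)) n)
    (Equiv.natSumNatEquivNat.symm m)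

theorem measurable_decode : Measurable decode := by
  refine measurable_pi_iff.2 fun m => ?_
  unfold decode
  rcases Equiv.natSumNatEquivNat.symm m with n | n
  · exact measurable_nthPoint n
  · exact ((measurable_nthPoint n).comp
      (measurable_pi_iff.2 fun q => measurable_pi_apply (-q))).neg

/-- The points `t i` are distinct, locally finite and unbounded on both sides. -/
structure Scattered (t : ℕ → ℝ) : Prop where
  injective : Function.Injective t
  locFin : ∀ L : ℝ, {i | |t i| ≤ L}.Finite
  unbounded : ∀ L : ℝ, (∃ i, L < t i) ∧ ∃ i, t i < L

theorem encard_preimage_eq {t w : ℕ → ℝ} (ht : Function.Injective t) (hw : Function.Injective w)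
    {A : Set ℝ} {M : Set ℕ} (h : w '' M = A ∩ Set.range t) : (t ⁻¹' A).encard = M.encard := by
  rw [← hw.encard_image M, h, ← ht.encard_image, Set.image_preimage_eq_inter_range]

/-- The canonical enumeration of the points of a scattered sequence is a permutation of it. -/
theorem Scattered.exists_decode_eq {t : ℕ → ℝ} (ht : Scattered t) :
    ∃ e : ℕ ≃ ℕ, decode (countVec ray t) = t ∘ e := by
  have hfin : ∀ L, (Set.range t ∩ {x | |x| ≤ L}).Finite := fun L => by
    refine ((ht.locFin L).image t).subset ?_
    rintro _ ⟨⟨i, rfl⟩, hi⟩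
    exact ⟨i, hi, rfl⟩
  obtain ⟨v, hv, hvr⟩ := exists_strictMono_range_eq (s := {x | 0 ≤ x ∧ x ∈ Set.range t})
    (fun L => by
      obtain ⟨i, hi⟩ := (ht.unbounded (max L 0)).1
      exact ⟨t i, ⟨(le_max_right _ _).trans hi.le, i, rfl⟩, (le_max_left _ _).trans_lt hi⟩)
    (fun L => (hfin L).subset fun x hx => ⟨hx.1.2, by
      simpa [abs_of_nonneg hx.1.1] using hx.2⟩)
  obtain ⟨w, hw, hwr⟩ := exists_strictMono_range_eq (s := {x | 0 < x ∧ -x ∈ Set.range t})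
    (fun L => by
      obtain ⟨i, hi⟩ := (ht.unbounded (-max L 0)).2
      refine ⟨-t i, ⟨?_, i, by simp⟩, ?_⟩
      · linarith [le_max_right L 0]
      · linarith [le_max_left L 0])
    (fun L => by
      refine ((hfin L).image fun x => -x).subset fun x hx => ⟨-x, ⟨hx.1.2, ?_⟩, by simp⟩
      simpa [abs_of_pos hx.1.1] using hx.2)
  have hv' : ∀ n, 0 ≤ v n ∧ v n ∈ Set.range t := fun n => by
    have : v n ∈ Set.range v := ⟨n, rfl⟩
    rwa [hvr] at this
  have hw' : ∀ n, 0 < w n ∧ -w n ∈ Set.range t := fun n => by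
    have : w n ∈ Set.range w := ⟨n, rfl⟩
    rwa [hwr] at this
  have hwneg : Function.Injective fun n => -w n := neg_injective.comp hw.injective
  have e1 : nthPoint (countVec ray t) = v := by
    refine nthPoint_eq hv (fun n => (hv' n).1) fun q hq => ?_
    have hq' : (0 : ℝ) < q := by exact_mod_cast hq
    rw [countVec, countingMeasure_eq_encard _ (measurableSet_ray q),
      encard_preimage_eq ht.injective hv.injective]
    ext x
    simp only [ray, Set.mem_image, Set.mem_inter_iff, Set.mem_union, Set.mem_Icc, Set.mem_Ico]
    constructor
    · rintro ⟨n, hn, rfl⟩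
      exact ⟨Or.inl ⟨(hv' n).1, hn⟩, (hv' n).2⟩
    · rintro ⟨h | h, hx⟩
      · obtain ⟨n, rfl⟩ : x ∈ Set.range v := by rw [hvr]; exact ⟨h.1, hx⟩
        exact ⟨n, h.2, rfl⟩
      · linarith
  have e2 : nthPoint (fun q => countVec ray t (-q)) = w := by
    refine nthPoint_eq hw (fun n => (hw' n).1.le) fun q hq => ?_
    have hq' : (0 : ℝ) < q := by exact_mod_cast hq
    rw [countVec, countingMeasure_eq_encard _ (measurableSet_ray _),
      encard_preimage_eq ht.injective hwneg]
    ext x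
    simp only [ray, Set.mem_image, Set.mem_inter_iff, Set.mem_union, Set.mem_Icc, Set.mem_Ico,
      Rat.cast_neg]
    constructor
    · rintro ⟨n, hn, rfl⟩
      refine ⟨Or.inr ⟨neg_le_neg hn, by linarith [(hw' n).1]⟩, (hw' n).2⟩
    · rintro ⟨h | h, hx⟩
      · linarith
      · obtain ⟨n, hn⟩ : -x ∈ Set.range w := by
          rw [hwr]; exact ⟨by linarith [h.2], by simpa using hx⟩
        refine ⟨n, ?_, by simp [hn]⟩
        show w n ≤ q
        linarith [h.1]
  have hd : decode (countVec ray t) =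
      Sum.elim v (fun n => -w n) ∘ Equiv.natSumNatEquivNat.symm := by
    ext m
    simp only [decode, e1, e2, Function.comp]
  have hinj : Function.Injective (decode (countVec ray t)) := by
    rw [hd]
    refine Function.Injective.comp ?_ (Equiv.injective _)
    refine hv.injective.sumElim hwneg fun a b h => ?_
    have := (hv' a).1
    have := (hw' b).1
    linarith
  have hrange : Set.range (decode (countVec ray t)) = Set.range t := by
    rw [hd, Set.range_comp, Equiv.range_eq_univ, Set.image_univ, Set.Sum.elim_range]
    apply Set.Subset.antisymm
    · rintro _ (⟨n, rfl⟩ | ⟨n, rfl⟩)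
      exacts [(hv' n).2, (hw' n).2]
    · rintro x hx
      rcases le_or_gt 0 x with h | h
      · left; rw [hvr]; exact ⟨h, hx⟩
      · right
        obtain ⟨n, hn⟩ : -x ∈ Set.range w := by
          rw [hwr]; exact ⟨by linarith, by simpa using hx⟩
        exact ⟨n, by simp [hn]⟩
  refine ⟨(Equiv.ofInjective _ hinj).trans ((Equiv.setCongr hrange).trans
    (Equiv.ofInjective t ht.injective).symm), ?_⟩
  ext m
  simp only [Function.comp, Equiv.trans_apply]
  rw [Equiv.apply_ofInjective_symm ht.injective]
  rfl

/-! ### Almost sure regularity of a Poisson process -/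

section Windows

variable {Ω : Type*} [MeasurableSpace Ω] {P : Measure Ω} {lam : ℝ≥0}
  {T : ℕ → Ω → ℝ}

/-- Among disjoint windows of the same length, infinitely many contain a prescribed number of
points. -/
theorem IsPoissonProcess.ae_exists_window (hT : IsPoissonProcess P lam T) (hlam : 0 < lam)
    {W : ℕ → Set ℝ} (hW : ∀ k, MeasurableSet (W k)) (hd : Pairwise (Function.onFun Disjoint W))
    {v : ℝ≥0} (hv : 0 < v) (hvol : ∀ k, volume (W k) = v) (n : ℕ) :
    ∀ᵐ ω ∂P, ∀ L, ∃ k, L ≤ k ∧ countingMeasure (fun i => T i ω) (W k) = n := by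
  rw [ae_all_iff]
  intro L
  rw [ae_iff]
  set r : ℝ≥0∞ := poissonMeasure (lam * v) {n}ᶜ with hr
  have hr1 : r < 1 := by
    rw [hr, prob_compl_eq_one_sub (measurableSet_singleton n)]
    refine ENNReal.sub_lt_self ENNReal.one_ne_top one_ne_zero ?_
    rw [poissonMeasure_singleton]
    have : 0 < lam * v := mul_pos hlam hv
    exact (ENNReal.ofReal_pos.2 (by positivity)).ne'
  have hS : MeasurableSet ({(n : ℝ≥0∞)}ᶜ : Set ℝ≥0∞) := (measurableSet_singleton _).compl
  have hone : ∀ k, P ((fun ω => countingMeasure (fun i => T i ω) (W k)) ⁻¹' {(n : ℝ≥0∞)}ᶜ) = r := by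
    intro k
    have h := (hT.hasLaw_count (W k) (hW k) (by rw [hvol]; exact ENNReal.coe_ne_top)).map_eq
    rw [← Measure.map_apply (hT.measurable_count (hW k)) hS, h, hvol, ENNReal.toNNReal_coe,
      Measure.map_apply (measurable_of_countable _) hS, hr]
    congr 1
    ext m
    simp
  -- The first `N` windows beyond `L` fail independently, each with probability `r < 1`.
  have hle : ∀ N : ℕ, P {ω | ¬∃ k, L ≤ k ∧ countingMeasure (fun i => T i ω) (W k) = n} ≤ r ^ N := by
    intro N
    have hind := hT.indep_count N (fun k => W (L + k)) (fun _ => hW _)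
      (fun a b h => hd (fun h' => h (Fin.ext (by omega))))
    have h := hind.measure_inter_preimage_eq_mul Finset.univ (sets := fun _ => {(n : ℝ≥0∞)}ᶜ)
      (fun _ _ => hS)
    simp only [hone, Finset.prod_const, Finset.card_univ, Fintype.card_fin] at h
    rw [← h]
    refine measure_mono fun ω hω => ?_
    simp only [Set.mem_iInter]
    intro k _ hk
    exact hω ⟨L + k, by omega, hk⟩
  exact le_antisymm (ge_of_tendsto' (ENNReal.tendsto_pow_atTop_nhds_zero_of_lt_one hr1) hle)
    bot_le

/-- Far away on both sides there are windows `[k d, (k + 1) d)`, `k : ℤ`, with a prescribed number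
of points. -/
theorem IsPoissonProcess.ae_exists_int_window (hT : IsPoissonProcess P lam T) (hlam : 0 < lam)
    {d : ℝ} (hd : 0 < d) (n : ℕ) :
    ∀ᵐ ω ∂P, ∀ L : ℕ,
      (∃ k : ℤ, (L : ℤ) ≤ k ∧
        countingMeasure (fun i => T i ω) (Set.Ico (k • d) ((k + 1) • d)) = n) ∧
      ∃ k : ℤ, k ≤ -(L : ℤ) ∧
        countingMeasure (fun i => T i ω) (Set.Ico (k • d) ((k + 1) • d)) = n := by
  have hdis := Set.pairwise_disjoint_Ico_zsmul d
  have hvol : ∀ k : ℤ, volume (Set.Ico (k • d) ((k + 1) • d)) = (d.toNNReal : ℝ≥0∞) := fun k => by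
    rw [Real.volume_Ico, add_smul, one_smul, add_sub_cancel_left]; rfl
  have h1 := hT.ae_exists_window hlam (W := fun k : ℕ => Set.Ico ((k : ℤ) • d) (((k : ℤ) + 1) • d))
    (fun _ => measurableSet_Ico) (fun a b h => hdis (by exact_mod_cast h))
    (Real.toNNReal_pos.2 hd) (fun k => hvol k) n
  have h2 := hT.ae_exists_window hlam
    (W := fun k : ℕ => Set.Ico ((-(k : ℤ)) • d) ((-(k : ℤ) + 1) • d))
    (fun _ => measurableSet_Ico) (fun a b h => hdis (by simpa using h))
    (Real.toNNReal_pos.2 hd) (fun k => hvol _) n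
  filter_upwards [h1, h2] with ω h1 h2 L
  obtain ⟨k, hk, h⟩ := h1 L
  obtain ⟨k', hk', h'⟩ := h2 L
  exact ⟨⟨k, by omega, h⟩, -k', by omega, h'⟩

theorem IsPoissonProcess.ae_locFin (hT : IsPoissonProcess P lam T) :
    ∀ᵐ ω ∂P, ∀ L : ℝ, {i | |T i ω| ≤ L}.Finite := by
  have h : ∀ᵐ ω ∂P, ∀ n : ℕ, countingMeasure (fun i => T i ω) (Set.Icc (-n : ℝ) n) ≠ ∞ := by
    rw [ae_all_iff]
    intro n
    have h := (hT.hasLaw_count (Set.Icc (-n : ℝ) n) measurableSet_Icc (by simp)).map_eq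
    have hS : MeasurableSet ({∞} : Set ℝ≥0∞) := measurableSet_singleton _
    rw [ae_iff]
    simp only [ne_eq, not_not]
    change P ((fun ω => countingMeasure (fun i => T i ω) (Set.Icc (-n : ℝ) n)) ⁻¹' {∞}) = 0
    rw [← Measure.map_apply (hT.measurable_count measurableSet_Icc) hS, h,
      Measure.map_apply (measurable_of_countable _) hS]
    convert measure_empty (μ := poissonMeasure _)
    ext m
    simp
  filter_upwards [h] with ω h L
  obtain ⟨n, hn⟩ := exists_nat_ge L
  have := h n
  rw [countingMeasure_eq_encard _ measurableSet_Icc, ne_eq, ENat.toENNReal_eq_top,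
    Set.encard_eq_top_iff, Set.not_infinite] at this
  refine this.subset fun i hi => ?_
  exact abs_le.1 (le_trans hi hn)

/-- A window containing a point occurs arbitrarily far on both sides. -/
theorem IsPoissonProcess.ae_scattered (hT : IsPoissonProcess P lam T) (hlam : 0 < lam) :
    ∀ᵐ ω ∂P, Scattered fun i => T i ω := by
  filter_upwards [hT.ae_injective, hT.ae_locFin,
    hT.ae_exists_int_window hlam one_pos 1] with ω h1 h2 h3
  refine ⟨h1, h2, fun L => ?_⟩
  have key : ∀ k : ℤ, countingMeasure (fun i => T i ω) (Set.Ico (k • (1 : ℝ)) ((k + 1) • 1)) =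
      (1 : ℕ) → ∃ i, (k : ℝ) ≤ T i ω ∧ T i ω < k + 1 := by
    intro k hk
    rw [countingMeasure_eq_encard _ measurableSet_Ico] at hk
    have : ((fun i => T i ω) ⁻¹' Set.Ico (k • (1 : ℝ)) ((k + 1) • 1)).Nonempty := by
      rw [Set.nonempty_iff_ne_empty]
      intro h
      rw [h] at hk
      simp at hk
    obtain ⟨i, hi⟩ := this
    exact ⟨i, by simpa using hi⟩
  obtain ⟨N, hN⟩ := exists_nat_gt (|L| + 1)
  obtain ⟨⟨k, hk, h⟩, ⟨k', hk', h'⟩⟩ := h3 N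
  obtain ⟨i, hi⟩ := key k h
  obtain ⟨i', hi'⟩ := key k' h'
  have a1 : (N : ℝ) ≤ k := by exact_mod_cast hk
  have a2 : (k' : ℝ) ≤ -N := by exact_mod_cast hk'
  have := neg_abs_le L
  have := le_abs_self L
  exact ⟨⟨i, by linarith [hi.1]⟩, ⟨i', by linarith [hi'.2]⟩⟩

/-- Empty intervals of every length occur arbitrarily far on both sides. -/
theorem IsPoissonProcess.ae_gaps (hT : IsPoissonProcess P lam T) (hlam : 0 < lam) :
    ∀ᵐ ω ∂P, ∀ D L : ℝ, (∃ s, L ≤ s ∧ ∀ j, T j ω ∉ Set.Icc s (s + D)) ∧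
      ∃ s, s ≤ L ∧ ∀ j, T j ω ∉ Set.Icc (s - D) s := by
  have h : ∀ᵐ ω ∂P, ∀ d L : ℕ, _ := ae_all_iff.2 fun d : ℕ =>
    hT.ae_exists_int_window hlam (d := (d : ℝ) + 1) (by positivity) 0
  filter_upwards [h] with ω h D L
  obtain ⟨d, hd⟩ := exists_nat_gt D
  obtain ⟨N, hN⟩ := exists_nat_ge (|L| + 1)
  have key : ∀ k : ℤ, countingMeasure (fun i => T i ω)
      (Set.Ico (k • ((d : ℝ) + 1)) ((k + 1) • ((d : ℝ) + 1))) = (0 : ℕ) →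
      ∀ j, T j ω ∉ Set.Ico (k * ((d : ℝ) + 1)) ((k + 1) * ((d : ℝ) + 1)) := by
    intro k hk j hj
    rw [countingMeasure_eq_encard _ measurableSet_Ico] at hk
    simp only [Nat.cast_zero, ENat.toENNReal_eq_zero, Set.encard_eq_zero] at hk
    have : j ∈ (fun i => T i ω) ⁻¹' (Set.Ico (k • ((d : ℝ) + 1)) ((k + 1) • ((d : ℝ) + 1))) := by
      simpa only [Set.mem_preimage, zsmul_eq_mul, Int.cast_add, Int.cast_one] using hj
    rw [hk] at this
    exact this
  obtain ⟨⟨k, hk, hk1⟩, ⟨k', hk', hk1'⟩⟩ := h d N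
  have a1 : (N : ℝ) ≤ k := by exact_mod_cast hk
  have a2 : (k' : ℝ) ≤ -N := by exact_mod_cast hk'
  have b1 := neg_abs_le L
  have b2 := le_abs_self L
  have b3 := abs_nonneg L
  have hd0 : (0 : ℝ) ≤ d := by positivity
  -- The windows are half-open of length `d + 1 > D + 1`, which leaves room for a closed interval of
  -- length `D`; on the left it is taken to end at distance `1 / 2` from the end of the window.
  refine ⟨⟨k * ((d : ℝ) + 1), by nlinarith, fun j hj => key k hk1 j ⟨hj.1, ?_⟩⟩,
    ⟨k' * ((d : ℝ) + 1) + d + 1 / 2, ?_, fun j hj => key k' hk1' j ⟨?_, ?_⟩⟩⟩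
  · have := hj.2
    linarith
  · nlinarith
  · have := hj.1
    linarith
  · have := hj.2
    linarith

end Windows

/-! ### Functions of a Poisson process that do not depend on the enumeration -/

/-- A function of sequences that only depends on the sequence up to permutation. -/
def PermInvariant {α β : Type*} (g : (ℕ → α) → β) : Prop :=
  ∀ (e : ℕ ≃ ℕ) (t : ℕ → α), g (t ∘ e) = g t

theorem measurable_cons {α : Type*} [MeasurableSpace α] :
    Measurable fun y : α × (ℕ → α) => cons y.1 y.2 := by
  refine measurable_pi_iff.2 fun n => ?_
  cases n with
  | zero => exact measurable_fst
  | succ n => exact (measurable_pi_apply n).comp measurable_snd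

/-- A permutation of the terms of a sequence, extended to a new first term. -/
def consEquiv (e : ℕ ≃ ℕ) : ℕ ≃ ℕ where
  toFun := fun | 0 => 0 | n + 1 => e n + 1
  invFun := fun | 0 => 0 | n + 1 => e.symm n + 1
  left_inv n := by cases n <;> simp
  right_inv n := by cases n <;> simp

theorem cons_comp {α : Type*} (a : α) (s : ℕ → α) (e : ℕ ≃ ℕ) :
    cons a (s ∘ e) = cons a s ∘ consEquiv e := by
  ext n
  cases n <;> rfl

theorem Scattered.cons {t : ℕ → ℝ} (ht : Scattered t) {x : ℝ} (hx : x ∉ Set.range t) :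
    Scattered (cons x t) := by
  refine ⟨?_, fun L => ?_, fun L => ?_⟩
  · rintro (_ | a) (_ | b) h
    · rfl
    · exact absurd ⟨b, h.symm⟩ hx
    · exact absurd ⟨a, h⟩ hx
    · exact congrArg _ (ht.injective h)
  · refine (((ht.locFin L).image Nat.succ).insert 0).subset ?_
    rintro (_ | a) h
    · exact Or.inl rfl
    · exact Or.inr ⟨a, h, rfl⟩
  · obtain ⟨⟨i, hi⟩, ⟨i', hi'⟩⟩ := ht.unbounded L
    exact ⟨⟨i + 1, hi⟩, ⟨i' + 1, hi'⟩⟩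

section Unmarked

variable {Ω Ω' : Type*} [MeasurableSpace Ω] [MeasurableSpace Ω'] {P : Measure Ω} {P' : Measure Ω'}
  [IsProbabilityMeasure P] [IsProbabilityMeasure P'] {lam : ℝ≥0} {T : ℕ → Ω → ℝ} {T' : ℕ → Ω' → ℝ}

theorem Scattered.apply_decode {t : ℕ → ℝ} (ht : Scattered t) {g : (ℕ → ℝ) → ℝ≥0∞}
    (hg : PermInvariant g) : g (decode (countVec ray t)) = g t := by
  obtain ⟨e, he⟩ := ht.exists_decode_eq
  rw [he, hg]

/-- The law of a Poisson process, as an unordered set of points, is determined by its intensity. -/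
theorem IsPoissonProcess.lintegral_eq (hT : IsPoissonProcess P lam T)
    (hT' : IsPoissonProcess P' lam T') (hlam : 0 < lam) {g : (ℕ → ℝ) → ℝ≥0∞} (hgm : Measurable g)
    (hg : PermInvariant g) :
    ∫⁻ ω, g (fun i => T i ω) ∂P = ∫⁻ ω, g (fun i => T' i ω) ∂P' := by
  have hd : Measurable fun c => g (decode c) := hgm.comp measurable_decode
  have hm : Measurable fun ω => countVec ray fun i => T i ω :=
    (measurable_countVec measurableSet_ray).comp hT.measurable
  have hm' : Measurable fun ω => countVec ray fun i => T' i ω :=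
    (measurable_countVec measurableSet_ray).comp hT'.measurable
  rw [← lintegral_congr_ae ((hT.ae_scattered hlam).mono fun ω h => h.apply_decode hg),
    ← lintegral_congr_ae ((hT'.ae_scattered hlam).mono fun ω h => h.apply_decode hg),
    ← lintegral_map hd hm, ← lintegral_map hd hm',
    hT.map_countVec_eq hT' measurableSet_ray volume_ray_ne_top]

/-- The law of a Poisson process with an additional point is absolutely continuous with respect to
the law of the process, for almost every position of the additional point. -/
theorem IsPoissonProcess.ae_cons_eq_zero (hT : IsPoissonProcess P lam T) (hlam : 0 < lam)
    {g : (ℕ → ℝ) → ℝ≥0∞} (hgm : Measurable g) (hg : PermInvariant g)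
    (h0 : ∀ᵐ ω ∂P, g (fun i => T i ω) = 0) :
    ∀ᵐ ω ∂P, ∀ᵐ x : ℝ, g (cons x fun i => T i ω) = 0 := by
  have hray := measurable_countVec measurableSet_ray
  have hd : Measurable (g ∘ decode) := hgm.comp measurable_decode
  have hm : Measurable fun ω => countVec ray fun i => T i ω := hray.comp hT.measurable
  have hm1 : Measurable fun (y : ℝ × Ω) a =>
      countVec ray (fun i => T i y.2) a + (ray a).indicator (1 : ℝ → ℝ≥0∞) y.1 := by
    refine measurable_pi_iff.2 fun a => ?_
    exact (((measurable_pi_apply a).comp hm).comp measurable_snd).add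
      ((measurable_one.indicator (measurableSet_ray a)).comp measurable_fst)
  have h1 : ∀ᵐ ω ∂P, (g ∘ decode) (countVec ray fun i => T i ω) = 0 := by
    filter_upwards [h0, hT.ae_scattered hlam] with ω h hs
    rw [Function.comp, hs.apply_decode hg, h]
  have h2 : ∀ q : ℚ, ∀ᵐ ω ∂P, ∀ᵐ x ∂volume.restrict (ray q), g (cons x fun i => T i ω) = 0 := by
    intro q
    have hS : MeasurableSet {c | (g ∘ decode) c = 0} := hd (measurableSet_singleton 0)
    -- The event has probability zero also under the law weighted by the number of points in `ray q`,
    -- which is the law of the process with a point added in `ray q`.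
    have h3 : ∀ᵐ c ∂(P.withDensity fun ω => countingMeasure (fun i => T i ω) (ray q)).map
        (fun ω => countVec ray fun i => T i ω), (g ∘ decode) c = 0 := by
      rw [ae_map_iff hm.aemeasurable hS]
      exact (withDensity_absolutelyContinuous _ _).ae_le h1
    rw [hT.mecke measurableSet_ray volume_ray_ne_top q, ae_map_iff hm1.aemeasurable hS] at h3
    have h4 : ∀ᵐ y ∂(volume.restrict (ray q)).prod P, (g ∘ decode)
        (fun a => countVec ray (fun i => T i y.2) a + (ray a).indicator 1 y.1) = 0 := by
      rw [ae_iff] at h3 ⊢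
      rw [Measure.smul_apply, ENNReal.smul_def, smul_eq_mul, mul_eq_zero] at h3
      exact h3.resolve_left (by exact_mod_cast hlam.ne')
    have h5 := (Measure.ae_ae_comm (p := fun x ω => (g ∘ decode)
      (fun a => countVec ray (fun i => T i ω) a + (ray a).indicator 1 x) = 0)
      (hm1 hS)).1 (Measure.ae_ae_of_ae_prod h4)
    filter_upwards [h5, hT.ae_scattered hlam] with ω h5 hs
    have hcount : ∀ᵐ x ∂volume.restrict (ray q), x ∉ Set.range fun i => T i ω :=
      ae_restrict_of_ae ((Set.countable_range _).ae_notMem _)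
    filter_upwards [h5, hcount] with x hx hxr
    rw [← (hs.cons hxr).apply_decode hg, ← hx, Function.comp]
    congr 2
    ext a
    rw [countVec, countingMeasure_cons _ _ (measurableSet_ray a), countVec]
  filter_upwards [ae_all_iff.2 h2] with ω h
  rw [← Measure.restrict_univ (μ := (volume : Measure ℝ)), ← iUnion_ray]
  exact (ae_restrict_iUnion_iff _ _).2 h

end Unmarked

/-! ### Independent marks -/

section Marks

/-- An i.i.d. sequence is invariant under permutations. -/
theorem infinitePi_map_comp (ν : Measure ℕ) [IsProbabilityMeasure ν] (e : ℕ ≃ ℕ) :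
    (Measure.infinitePi fun _ : ℕ => ν).map (fun d => d ∘ e) = Measure.infinitePi fun _ => ν := by
  refine Measure.eq_infinitePi _ fun s t ht => ?_
  have hm : Measurable fun d : ℕ → ℕ => d ∘ e :=
    measurable_pi_iff.2 fun n => measurable_pi_apply (e n)
  rw [Measure.map_apply hm (MeasurableSet.pi s.countable_toSet fun i _ => ht i)]
  have : (fun d : ℕ → ℕ => d ∘ e) ⁻¹' (Set.pi s t) =
      Set.pi (s.map e.toEmbedding) (fun i => t (e.symm i)) := by
    ext d
    simp only [Set.mem_preimage, Set.mem_pi, Finset.mem_coe, Finset.mem_map_equiv,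
      Function.comp_apply]
    exact ⟨fun h i hi => by simpa using h _ hi, fun h i hi => by simpa using h (e i) (by simpa)⟩
  rw [this, Measure.infinitePi_pi _ (fun i _ => ht _), Finset.prod_map]
  simp

/-- An independent term of the same law in front of an i.i.d. sequence gives an i.i.d. sequence. -/
theorem infinitePi_eq_map_cons (ν : Measure ℕ) [IsProbabilityMeasure ν] :
    (ν.prod (Measure.infinitePi fun _ : ℕ => ν)).map (fun y => cons y.1 y.2) =
      Measure.infinitePi fun _ => ν := by
  classical
  refine Measure.eq_infinitePi _ fun s t ht => ?_
  rw [Measure.map_apply measurable_cons (MeasurableSet.pi s.countable_toSet fun i _ => ht i)]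
  have : (fun y : ℕ × (ℕ → ℕ) => cons y.1 y.2) ⁻¹' (Set.pi s t) =
      (if 0 ∈ s then t 0 else Set.univ) ×ˢ
        Set.pi (s.preimage (· + 1) (add_left_injective 1).injOn) (fun i => t (i + 1)) := by
    ext ⟨m, d⟩
    simp only [Set.mem_preimage, Set.mem_pi, Set.mem_prod, Finset.mem_coe, Finset.mem_preimage]
    constructor
    · intro h
      refine ⟨?_, fun i hi => h _ hi⟩
      split_ifs with h0
      · exact h 0 h0
      · trivial
    · rintro ⟨h0, h⟩ (_ | i) hi
      · rw [if_pos hi] at h0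
        exact h0
      · exact h i hi
  rw [this, Measure.prod_prod, Measure.infinitePi_pi _ (fun i _ => ht _),
    Finset.prod_preimage' (· + 1) s (add_left_injective 1).injOn (fun i => ν (t i))]
  have hr : ∀ x, x ∈ Set.range (fun x : ℕ => x + 1) ↔ ¬ x = 0 := by
    intro x
    constructor
    · rintro ⟨y, rfl⟩; simp
    · intro h; exact ⟨x - 1, by simp only; omega⟩
  simp only [hr]
  rw [← Finset.prod_filter_mul_prod_filter_not s (fun x => x = 0) (fun i => ν (t i))]
  congr 1
  by_cases h0 : 0 ∈ s
  · simp [h0, Finset.filter_eq']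
  · simp [h0, Finset.filter_eq']

/-- The configuration of the points `t i` with marks `d i`. -/
def zip (t : ℕ → ℝ) (d : ℕ → ℕ) (i : ℕ) : ℝ × ℕ := (t i, d i)

theorem measurable_zip : Measurable fun y : (ℕ → ℝ) × (ℕ → ℕ) => zip y.1 y.2 :=
  measurable_pi_iff.2 fun i => ((measurable_pi_apply i).comp measurable_fst).prodMk
    ((measurable_pi_apply i).comp measurable_snd)

theorem zip_cons (x : ℝ) (t : ℕ → ℝ) (m : ℕ) (d : ℕ → ℕ) :
    zip (cons x t) (cons m d) = cons (x, m) (zip t d) := by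
  ext1 n
  cases n <;> rfl

theorem IsMarkedPoissonProcess.measurable {Ω : Type*} [MeasurableSpace Ω]
    {P : Measure Ω} {lam : ℝ≥0} {ν : Measure ℕ} {T : ℕ → Ω → ℝ} {D : ℕ → Ω → ℕ}
    (h : IsMarkedPoissonProcess P lam ν T D) :
    Measurable fun ω i => (T i ω, D i ω) :=
  measurable_pi_iff.2 fun i => (h.poisson.measurable_point i).prodMk (h.measurable_mark i)

variable {Ω Ω' : Type*} [MeasurableSpace Ω] [MeasurableSpace Ω'] {P : Measure Ω} {P' : Measure Ω'}
  [IsProbabilityMeasure P] [IsProbabilityMeasure P'] {lam : ℝ≥0} {ν : Measure ℕ}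
  [IsProbabilityMeasure ν] {T : ℕ → Ω → ℝ} {T' : ℕ → Ω' → ℝ} {D : ℕ → Ω → ℕ} {D' : ℕ → Ω' → ℕ}

/-- Expectations over a marked Poisson process, computed by integrating over the marks first. -/
theorem IsMarkedPoissonProcess.lintegral_eq_lintegral_marks
    (h : IsMarkedPoissonProcess P lam ν T D) {G : (ℕ → ℝ × ℕ) → ℝ≥0∞} (hG : Measurable G) :
    ∫⁻ ω, G (fun i => (T i ω, D i ω)) ∂P =
      ∫⁻ ω, ∫⁻ d, G (zip (fun i => T i ω) d) ∂(Measure.infinitePi fun _ => ν) ∂P := by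
  have hD : Measurable fun ω i => D i ω := measurable_pi_iff.2 h.measurable_mark
  have hT := h.poisson.measurable
  have h1 : P.map (fun ω i => D i ω) = Measure.infinitePi fun _ => ν := by
    rw [h.indep_mark.map_fun_eq_infinitePi_map₀ hD.aemeasurable]
    congr 1
    ext1 i
    exact (h.hasLaw_mark i).map_eq
  have h2 := (indepFun_iff_map_prod_eq_prod_map_map hT.aemeasurable hD.aemeasurable).1
    h.indep_point_mark
  rw [h1] at h2
  have hm := hG.comp measurable_zip
  have h3 := lintegral_map (μ := P) hm (hT.prodMk hD)
  rw [h2, lintegral_prod _ hm.aemeasurable] at h3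
  rw [lintegral_map hm.lintegral_prod_right' hT] at h3
  exact h3.symm

theorem permInvariant_lintegral_marks {G : (ℕ → ℝ × ℕ) → ℝ≥0∞} (hGm : Measurable G)
    (hG : PermInvariant G) :
    PermInvariant fun t => ∫⁻ d, G (zip t d) ∂(Measure.infinitePi fun _ => ν) := by
  intro e t
  have hm : Measurable fun d : ℕ → ℕ => d ∘ e :=
    measurable_pi_iff.2 fun n => measurable_pi_apply (e n)
  have hz : ∀ t, Measurable fun d => G (zip t d) := fun t =>
    hGm.comp (measurable_zip.comp measurable_prodMk_left)
  simp only
  conv_lhs => rw [← infinitePi_map_comp ν e]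
  rw [lintegral_map (hz _) hm]
  refine lintegral_congr fun d => ?_
  exact hG e (zip t d)

/-- The law of a marked Poisson process, as an unordered set of marked points, is determined by its
intensity and the law of the marks. -/
theorem IsMarkedPoissonProcess.lintegral_eq (h : IsMarkedPoissonProcess P lam ν T D)
    (h' : IsMarkedPoissonProcess P' lam ν T' D') (hlam : 0 < lam) {G : (ℕ → ℝ × ℕ) → ℝ≥0∞}
    (hGm : Measurable G) (hG : PermInvariant G) :
    ∫⁻ ω, G (fun i => (T i ω, D i ω)) ∂P = ∫⁻ ω, G (fun i => (T' i ω, D' i ω)) ∂P' := by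
  rw [h.lintegral_eq_lintegral_marks hGm, h'.lintegral_eq_lintegral_marks hGm]
  exact h.poisson.lintegral_eq h'.poisson hlam (hGm.comp measurable_zip).lintegral_prod_right'
    (permInvariant_lintegral_marks hGm hG)

/-- The law of a marked Poisson process with an additional independently marked point is absolutely
continuous with respect to the law of the process. -/
theorem IsMarkedPoissonProcess.ae_cons (h : IsMarkedPoissonProcess P lam ν T D) (hlam : 0 < lam)
    {G : (ℕ → ℝ × ℕ) → Prop} (hGm : MeasurableSet {c | G c}) (hG : PermInvariant G)
    (h0 : ∀ᵐ ω ∂P, G fun i => (T i ω, D i ω)) :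
    ∀ᵐ ω ∂P, ∀ᵐ y ∂(volume : Measure ℝ).prod ν, G (cons y fun i => (T i ω, D i ω)) := by
  classical
  set F : (ℕ → ℝ × ℕ) → ℝ≥0∞ := {c | G c}ᶜ.indicator 1 with hF
  have hFm : Measurable F := measurable_one.indicator hGm.compl
  have hF0 : ∀ c, F c = 0 ↔ G c := fun c => by simp [hF, Set.indicator_apply]
  have hFp : PermInvariant F := fun e t => by
    have := hG e t
    simp only [hF, Set.indicator_apply, Set.mem_compl_iff, Set.mem_ofPred_eq, this,
      Pi.one_apply]
  have hzm := hFm.comp measurable_zip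
  have h1 : ∀ᵐ ω ∂P, ∫⁻ d, F (zip (fun i => T i ω) d) ∂(Measure.infinitePi fun _ => ν) = 0 := by
    have hm : Measurable fun t => ∫⁻ d, F (zip t d) ∂(Measure.infinitePi fun _ => ν) :=
      hzm.lintegral_prod_right'
    have := h.lintegral_eq_lintegral_marks hFm
    rw [lintegral_congr_ae (h0.mono fun ω hω => (hF0 _).2 hω), lintegral_zero] at this
    exact (lintegral_eq_zero_iff (hm.comp h.poisson.measurable)).1 this.symm
  have h2 := h.poisson.ae_cons_eq_zero hlam hzm.lintegral_prod_right'
    (permInvariant_lintegral_marks (ν := ν) hFm hFp) h1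
  have hcm : Measurable fun z : (ℕ → ℝ × ℕ) × (ℝ × ℕ) => F (cons z.2 z.1) :=
    hFm.comp (measurable_cons.comp measurable_swap)
  have hKm : Measurable fun c => ∫⁻ y, F (cons y c) ∂(volume : Measure ℝ).prod ν :=
    hcm.lintegral_prod_right'
  have h3 : ∫⁻ ω, ∫⁻ y, F (cons y fun i => (T i ω, D i ω)) ∂(volume : Measure ℝ).prod ν ∂P = 0 := by
    rw [h.lintegral_eq_lintegral_marks hKm]
    rw [← lintegral_zero (μ := P)]
    refine lintegral_congr_ae ?_
    filter_upwards [h2] with ω hω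
    have hcm' : Measurable fun z : (ℕ → ℕ) × (ℝ × ℕ) => F (cons z.2 (zip (fun i => T i ω) z.1)) :=
      hcm.comp ((measurable_zip.comp (measurable_const.prodMk measurable_fst)).prodMk
        measurable_snd)
    have hcm'' : Measurable fun z : (ℝ × ℕ) × (ℕ → ℕ) => F (cons z.1 (zip (fun i => T i ω) z.2)) :=
      hcm'.comp measurable_swap
    -- Tonelli moves the mark of the new point to the front of the marks of the old points.
    rw [lintegral_lintegral_swap hcm'.aemeasurable,
      lintegral_prod _ hcm''.lintegral_prod_right'.aemeasurable, ← lintegral_zero (μ := (volume : Measure ℝ))]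
    refine lintegral_congr_ae (hω.mono fun x hx => ?_)
    have hx1 : Measurable fun d => F (zip (cons x fun i => T i ω) d) :=
      hFm.comp (measurable_zip.comp measurable_prodMk_left)
    have hx2 : Measurable fun a : ℕ × (ℕ → ℕ) =>
      F (zip (cons x fun i => T i ω) (cons a.1 a.2)) := hx1.comp measurable_cons
    simp only [Function.comp] at hx
    rw [← infinitePi_eq_map_cons, lintegral_map hx1 measurable_cons,
      lintegral_prod _ hx2.aemeasurable] at hx
    simp only [zip_cons] at hx
    exact hx
  filter_upwards [(lintegral_eq_zero_iff (hKm.comp h.measurable)).1 h3] with ω hω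
  have hm : Measurable fun y : ℝ × ℕ => F (cons y fun i => (T i ω, D i ω)) :=
    hcm.comp measurable_prodMk_left
  filter_upwards [(lintegral_eq_zero_iff hm).1 hω] with y hy
  exact (hF0 _).1 hy

end Marks

/-! ### Measurability and symmetries of the greedy matching -/

section Measurability

variable {α : Type*} [MeasurableSpace α]

theorem measurable_encard {φ : ℕ → α → Prop} (hφ : ∀ n, Measurable (φ n)) :
    Measurable fun x => ({n | φ n x}.encard : ℝ≥0∞) := by
  have : ∀ x, ({n | φ n x}.encard : ℝ≥0∞) = ∑' n, {x | φ n x}.indicator 1 x := fun x => by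
    rw [← ENNReal.tsum_set_one, tsum_subtype {n | φ n x} (fun _ => 1)]
    rfl
  simp_rw [this]
  have h : ∀ n, Measurable ({x | φ n x}.indicator (1 : α → ℝ≥0∞)) := fun n =>
    measurable_one.indicator (measurableSet_setOfPred.2 (hφ n))
  exact Measurable.tsum h

theorem measurable_encard_lt {φ : ℕ → α → Prop} (hφ : ∀ n, Measurable (φ n)) {k : α → ℕ}
    (hk : Measurable k) : Measurable fun x => ({n | φ n x}.encard < k x) := by
  have h1 : ∀ x, ({n | φ n x}.encard < k x) ↔ ({n | φ n x}.encard : ℝ≥0∞) < (k x : ℝ≥0∞) :=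
    fun x => by rw [← ENat.toENNReal_coe, ENat.toENNReal_lt]
  simp_rw [h1]
  exact measurableSet_setOfPred.1 (measurableSet_lt (measurable_encard hφ)
    ((measurable_of_countable fun n : ℕ => (n : ℝ≥0∞)).comp hk))

theorem measurable_encard_eq {φ : ℕ → α → Prop} (hφ : ∀ n, Measurable (φ n)) {k : α → ℕ}
    (hk : Measurable k) : Measurable fun x => ({n | φ n x}.encard = k x) := by
  have h1 : ∀ x, ({n | φ n x}.encard = k x) ↔ ({n | φ n x}.encard : ℝ≥0∞) = (k x : ℝ≥0∞) :=
    fun x => by rw [← ENat.toENNReal_coe, ENat.toENNReal_inj]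
  simp_rw [h1]
  exact measurableSet_setOfPred.1 (measurableSet_eq_fun (measurable_encard hφ)
    ((measurable_of_countable fun n : ℕ => (n : ℝ≥0∞)).comp hk))

theorem measurable_finite {φ : ℕ → α → Prop} (hφ : ∀ n, Measurable (φ n)) :
    Measurable fun x => {n | φ n x}.Finite := by
  have h1 : ∀ x, {n | φ n x}.Finite ↔ ({n | φ n x}.encard : ℝ≥0∞) < ∞ := fun x => by
    rw [← Set.encard_lt_top_iff, ← ENat.toENNReal_top, ENat.toENNReal_lt]
  simp_rw [h1]
  exact measurableSet_setOfPred.1 (measurableSet_lt (measurable_encard hφ) measurable_const)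

end Measurability

/-- A pair of a red and a blue configuration. -/
abbrev Config := (ℕ → ℝ × ℕ) × (ℕ → ℝ × ℕ)

theorem measurable_red (i : ℕ) : Measurable fun c : Config => c.1 i :=
  (measurable_pi_apply i).comp measurable_fst

theorem measurable_blue (i : ℕ) : Measurable fun c : Config => c.2 i :=
  (measurable_pi_apply i).comp measurable_snd

theorem measurable_gap (i j : ℕ) : Measurable fun c : Config => gap c.1 c.2 i j := by
  have h := (measurable_red i).fst.sub (measurable_blue j).fst
  exact h.norm

theorem measurable_gap_lt (i j i' j' : ℕ) :
    Measurable fun c : Config => gap c.1 c.2 i j < gap c.1 c.2 i' j' :=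
  measurableSet_setOfPred.1 (measurableSet_lt (measurable_gap i j) (measurable_gap i' j'))

theorem measurable_step {S : Config → ℕ → ℕ → Prop} (hS : ∀ i j, Measurable fun c => S c i j)
    (i j : ℕ) : Measurable fun c : Config => Step c.1 c.2 (S c) i j :=
  (measurable_encard_lt (fun j' => (measurable_gap_lt i j' i j).and (hS i j'))
    (measurable_red i).snd).and
    (measurable_encard_lt (fun i' => (measurable_gap_lt i' j i j).and (hS i' j))
      (measurable_blue j).snd)

theorem measurable_greedy (n i j : ℕ) : Measurable fun c : Config => greedy c.1 c.2 n i j := by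
  induction n generalizing i j with
  | zero => exact measurable_const
  | succ _ ih => exact measurable_step ih i j

theorem measurable_limitGreedy (i j : ℕ) :
    Measurable fun c : Config => limitGreedy c.1 c.2 i j :=
  Measurable.exists fun _ => Measurable.forall fun m =>
    measurable_const.imp (measurable_greedy m i j)

/-- There are no ties and the greedy algorithm produces a perfect stable matching. -/
def GreedyPerfect (p q : ℕ → ℝ × ℕ) : Prop :=
  NoTies p q ∧ IsPerfect p q (limitGreedy p q)

theorem measurable_greedyPerfect : Measurable fun c : Config => GreedyPerfect c.1 c.2 := by
  have h : ∀ p q, GreedyPerfect p q ↔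
      ((∀ i j j', gap p q i j = gap p q i j' → j = j') ∧
        ∀ i i' j, gap p q i j = gap p q i' j → i = i') ∧
      (∀ i j, limitGreedy p q i j ↔ Step p q (limitGreedy p q) i j) ∧
      (∀ i, {j | limitGreedy p q i j}.encard = (p i).2) ∧
      ∀ j, {i | limitGreedy p q i j}.encard = (q j).2 := fun p q =>
    ⟨fun h => ⟨⟨h.1.1, h.1.2⟩, h.2.1, h.2.2, h.2.3⟩,
      fun h => ⟨⟨h.1.1, h.1.2⟩, h.2.1, h.2.2.1, h.2.2.2⟩⟩
  simp_rw [h]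
  have hgap : ∀ i j i' j', Measurable fun c : Config => gap c.1 c.2 i j = gap c.1 c.2 i' j' :=
    fun i j i' j' =>
      measurableSet_setOfPred.1 (measurableSet_eq_fun (measurable_gap i j) (measurable_gap i' j'))
  refine ((Measurable.forall fun i => Measurable.forall fun j => Measurable.forall fun j' =>
    (hgap i j i j').imp measurable_const).and (Measurable.forall fun i => Measurable.forall fun i' =>
    Measurable.forall fun j => (hgap i j i' j).imp measurable_const)).and
    ((Measurable.forall fun i => Measurable.forall fun j => ?_).and
      ((Measurable.forall fun i => ?_).and (Measurable.forall fun j => ?_)))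
  · exact (measurable_limitGreedy i j).iff (measurable_step measurable_limitGreedy i j)
  · exact measurable_encard_eq (fun j => measurable_limitGreedy i j) (measurable_red i).snd
  · exact measurable_encard_eq (fun i => measurable_limitGreedy i j) (measurable_blue j).snd

/-- Only finitely many blue points desire `z` in the greedy matching. -/
def FinitelyDesired (z : ℝ) (p q : ℕ → ℝ × ℕ) : Prop :=
  {j | DesiresIn p q (limitGreedy p q) z j}.Finite

theorem measurable_finitelyDesired (z : ℝ) :
    Measurable fun c : Config => FinitelyDesired z c.1 c.2 := by
  refine measurable_finite fun j => Measurable.exists fun i => (measurable_limitGreedy i j).and ?_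
  have h : Measurable fun c : Config => |(c.2 j).1 - z| := ((measurable_blue j).fst.sub_const z).norm
  exact measurableSet_setOfPred.1 (measurableSet_lt h (measurable_gap i j))

theorem encard_setOf_comp (e : ℕ ≃ ℕ) (φ : ℕ → Prop) : {n | φ (e n)}.encard = {n | φ n}.encard :=
  Set.encard_preimage_of_bijective e.bijective {n | φ n}

section Permutations

variable (p q : ℕ → ℝ × ℕ) (e f : ℕ ≃ ℕ)

theorem step_comp (S : ℕ → ℕ → Prop) (i j : ℕ) :
    Step (p ∘ e) (q ∘ f) (fun i j => S (e i) (f j)) i j ↔ Step p q S (e i) (f j) := by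
  refine and_congr ?_ ?_
  · rw [← encard_setOf_comp f (fun j' => gap p q (e i) j' < gap p q (e i) (f j) ∧ S (e i) j')]
    rfl
  · rw [← encard_setOf_comp e (fun i' => gap p q i' (f j) < gap p q (e i) (f j) ∧ S i' (f j))]
    rfl

theorem greedy_comp (n : ℕ) :
    greedy (p ∘ e) (q ∘ f) n = fun i j => greedy p q n (e i) (f j) := by
  induction n with
  | zero => rfl
  | succ n ih =>
    ext i j
    rw [greedy, ih, step_comp, greedy]

theorem limitGreedy_comp :
    limitGreedy (p ∘ e) (q ∘ f) = fun i j => limitGreedy p q (e i) (f j) := by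
  ext i j
  simp only [limitGreedy, greedy_comp]

theorem greedyPerfect_comp_of (h : GreedyPerfect p q) : GreedyPerfect (p ∘ e) (q ∘ f) := by
  refine ⟨⟨fun i j j' h' => f.injective (h.1.red _ _ _ h'),
    fun i i' j h' => e.injective (h.1.blue _ _ _ h')⟩, ?_⟩
  rw [limitGreedy_comp]
  refine ⟨fun i j => ?_, fun i => ?_, fun j => ?_⟩
  · rw [step_comp]
    exact h.2.step_iff _ _
  · rw [encard_setOf_comp f]
    exact h.2.degree_red _
  · rw [encard_setOf_comp e (fun i => limitGreedy p q i (f j))]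
    exact h.2.degree_blue _

theorem greedyPerfect_comp : GreedyPerfect (p ∘ e) q ↔ GreedyPerfect p q := by
  refine ⟨fun h => ?_, greedyPerfect_comp_of p q e (Equiv.refl ℕ)⟩
  have := greedyPerfect_comp_of (p ∘ e) q e.symm (Equiv.refl ℕ) h
  have h2 : (p ∘ e) ∘ e.symm = p := by ext1 n; simp
  rw [h2] at this
  exact this

theorem finitelyDesired_comp (z : ℝ) :
    FinitelyDesired z (p ∘ e) (q ∘ f) ↔ FinitelyDesired z p q := by
  have h : ∀ j, DesiresIn (p ∘ e) (q ∘ f) (limitGreedy (p ∘ e) (q ∘ f)) z j ↔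
      DesiresIn p q (limitGreedy p q) z (f j) := fun j => by
    rw [limitGreedy_comp]
    exact e.exists_congr_left.trans (by simp [gap, DesiresIn])
  unfold FinitelyDesired
  simp_rw [h]
  rw [← Set.encard_lt_top_iff, ← Set.encard_lt_top_iff,
    encard_setOf_comp f (fun j => DesiresIn p q (limitGreedy p q) z j)]

end Permutations

/-- The configuration seen from `z`. -/
def shift (z : ℝ) (p : ℕ → ℝ × ℕ) (i : ℕ) : ℝ × ℕ := ((p i).1 - z, (p i).2)

theorem gap_shift (z : ℝ) (p q : ℕ → ℝ × ℕ) (i j : ℕ) :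
    gap (shift z p) (shift z q) i j = gap p q i j := by
  simp [gap, shift]

theorem limitGreedy_shift (z : ℝ) (p q : ℕ → ℝ × ℕ) :
    limitGreedy (shift z p) (shift z q) = limitGreedy p q := by
  have h : ∀ n, greedy (shift z p) (shift z q) n = greedy p q n := by
    intro n
    induction n with
    | zero => rfl
    | succ n ih =>
      ext i j
      rw [greedy, ih, greedy]
      simp only [Step, gap_shift, shift]
  ext i j
  simp only [limitGreedy, h]

theorem finitelyDesired_shift (z : ℝ) (p q : ℕ → ℝ × ℕ) :
    FinitelyDesired 0 (shift z p) (shift z q) ↔ FinitelyDesired z p q := by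
  simp only [FinitelyDesired, DesiresIn, limitGreedy_shift, gap_shift, shift, sub_zero]

/-! ### Adding several red points -/

/-- The property `G` holds after the addition of almost every marked red point. -/
def AfterAdding (ν : Measure ℕ) (G : (ℕ → ℝ × ℕ) → (ℕ → ℝ × ℕ) → Prop) (p q : ℕ → ℝ × ℕ) : Prop :=
  ∀ᵐ y ∂(volume : Measure ℝ).prod ν, G (cons y p) q

theorem measurable_afterAdding {ν : Measure ℕ} [IsProbabilityMeasure ν]
    {G : (ℕ → ℝ × ℕ) → (ℕ → ℝ × ℕ) → Prop} (hG : Measurable fun c : Config => G c.1 c.2) :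
    Measurable fun c : Config => AfterAdding ν G c.1 c.2 := by
  have hm : Measurable fun z : Config × (ℝ × ℕ) => ((cons z.2 z.1.1, z.1.2) : Config) :=
    (measurable_cons.comp (measurable_snd.prodMk measurable_fst.fst)).prodMk measurable_fst.snd
  have hS : MeasurableSet {z : Config × (ℝ × ℕ) | ¬ G (cons z.2 z.1.1) z.1.2} :=
    measurableSet_setOfPred.2 (hG.not.comp hm)
  exact measurableSet_setOfPred.1
    (measurable_measure_prodMk_left (ν := (volume : Measure ℝ).prod ν) hS (measurableSet_singleton 0))

theorem permInvariant_afterAdding {ν : Measure ℕ} {G : (ℕ → ℝ × ℕ) → (ℕ → ℝ × ℕ) → Prop}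
    (hG : ∀ q, PermInvariant fun p => G p q) (q : ℕ → ℝ × ℕ) :
    PermInvariant fun p => AfterAdding ν G p q := by
  intro e p
  unfold AfterAdding
  simp only [cons_comp, hG q (consEquiv e) _]

theorem exists_mem_of_ae_prod {ν : Measure ℕ} [IsProbabilityMeasure ν] (hν : ν {0} = 0) {a b : ℝ}
    (hab : a < b) {Q : ℝ × ℕ → Prop} (h : ∀ᵐ y ∂(volume : Measure ℝ).prod ν, Q y) :
    ∃ y, Q y ∧ y.1 ∈ Set.Icc a b ∧ 1 ≤ y.2 := by
  by_contra! hno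
  have h1 : (volume : Measure ℝ).prod ν (Set.Icc a b ×ˢ {0}ᶜ) = 0 := by
    refine measure_mono_null (t := {y | ¬ Q y}) (fun y hy => ?_) h
    intro hQ
    have := hno y hQ hy.1
    exact hy.2 (by simp only [Set.mem_singleton_iff]; omega)
  rw [Measure.prod_prod, prob_compl_eq_one_sub (measurableSet_singleton 0), hν, Real.volume_Icc,
    tsub_zero, mul_one, ENNReal.ofReal_eq_zero] at h1
  linarith

/-- If `G` holds after the addition of almost all `k`-tuples of red points, these may be chosen in a
given interval and with at least one stub. -/
theorem exists_extension {ν : Measure ℕ} [IsProbabilityMeasure ν] (hν : ν {0} = 0) {a b : ℝ}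
    (hab : a < b) {G : (ℕ → ℝ × ℕ) → (ℕ → ℝ × ℕ) → Prop} {q : ℕ → ℝ × ℕ} (k : ℕ)
    {p : ℕ → ℝ × ℕ} (h : (AfterAdding ν)^[k] G p q) :
    ∃ p', G p' q ∧ (∀ n, p' (n + k) = p n) ∧ ∀ n < k, (p' n).1 ∈ Set.Icc a b ∧ 1 ≤ (p' n).2 := by
  induction k generalizing p with
  | zero => exact ⟨p, h, fun _ => rfl, fun n hn => absurd hn (by omega)⟩
  | succ k ih =>
    rw [Function.iterate_succ_apply'] at h
    obtain ⟨y, hy, hy1, hy2⟩ := exists_mem_of_ae_prod hν hab h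
    obtain ⟨p', hp', h1, h2⟩ := ih hy
    refine ⟨p', hp', fun n => ?_, fun n hn => ?_⟩
    · rw [show n + (k + 1) = (n + 1) + k by ring, h1]; rfl
    · rcases Nat.lt_succ_iff_lt_or_eq.1 hn with hn | rfl
      · exact h2 n hn
      · have : p' (0 + n) = y := h1 0
        rw [zero_add] at this
        rw [this]
        exact ⟨hy1, hy2⟩

/-! ### Pairs of independent marked Poisson processes -/

section Pairs

variable {Ω Ω' : Type*} [MeasurableSpace Ω] [MeasurableSpace Ω'] {P : Measure Ω} {P' : Measure Ω'}
  [IsProbabilityMeasure P] [IsProbabilityMeasure P'] {lamR lamB : ℝ≥0} {ν μ : Measure ℕ}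
  {R : ℕ → Ω → ℝ} {X : ℕ → Ω → ℕ} {B : ℕ → Ω → ℝ} {Y : ℕ → Ω → ℕ}
  {R' : ℕ → Ω' → ℝ} {X' : ℕ → Ω' → ℕ} {B' : ℕ → Ω' → ℝ} {Y' : ℕ → Ω' → ℕ}

theorem map_pair_eq_prod (hR : IsMarkedPoissonProcess P lamR ν R X)
    (hB : IsMarkedPoissonProcess P lamB μ B Y)
    (hRB : IndepFun (fun ω i => (R i ω, X i ω)) (fun ω i => (B i ω, Y i ω)) P) :
    P.map (fun ω => ((fun i => (B i ω, Y i ω), fun i => (R i ω, X i ω)) : Config)) =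
      (P.map fun ω i => (B i ω, Y i ω)).prod (P.map fun ω i => (R i ω, X i ω)) :=
  (indepFun_iff_map_prod_eq_prod_map_map hB.measurable.aemeasurable hR.measurable.aemeasurable).1
    hRB.symm

theorem lintegral_pair (hR : IsMarkedPoissonProcess P lamR ν R X)
    (hB : IsMarkedPoissonProcess P lamB μ B Y)
    (hRB : IndepFun (fun ω i => (R i ω, X i ω)) (fun ω i => (B i ω, Y i ω)) P)
    {F : (ℕ → ℝ × ℕ) → (ℕ → ℝ × ℕ) → ℝ≥0∞} (hF : Measurable fun c : Config => F c.1 c.2) :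
    ∫⁻ ω, F (fun i => (R i ω, X i ω)) (fun i => (B i ω, Y i ω)) ∂P =
      ∫⁻ ω', ∫⁻ ω, F (fun i => (R i ω, X i ω)) (fun i => (B i ω', Y i ω')) ∂P ∂P := by
  have hF' : Measurable fun c : Config => F c.2 c.1 := hF.comp measurable_swap
  have h := lintegral_map (μ := P) hF' (hB.measurable.prodMk hR.measurable)
  rw [map_pair_eq_prod hR hB hRB, lintegral_prod _ hF'.aemeasurable,
    lintegral_map hF'.lintegral_prod_right' hB.measurable] at h
  rw [← h]
  exact lintegral_congr fun ω => lintegral_map (hF'.comp measurable_prodMk_left) hR.measurable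

/-- By independence, the blue configuration may be frozen in almost sure statements. -/
theorem ae_pair_iff (hR : IsMarkedPoissonProcess P lamR ν R X)
    (hB : IsMarkedPoissonProcess P lamB μ B Y)
    (hRB : IndepFun (fun ω i => (R i ω, X i ω)) (fun ω i => (B i ω, Y i ω)) P)
    {G : (ℕ → ℝ × ℕ) → (ℕ → ℝ × ℕ) → Prop} (hG : Measurable fun c : Config => G c.1 c.2) :
    (∀ᵐ ω ∂P, G (fun i => (R i ω, X i ω)) (fun i => (B i ω, Y i ω))) ↔
      ∀ᵐ q ∂(P.map fun ω i => (B i ω, Y i ω)), ∀ᵐ ω ∂P, G (fun i => (R i ω, X i ω)) q := by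
  have hG' : MeasurableSet {c : Config | G c.2 c.1} :=
    measurableSet_setOfPred.2 (hG.comp measurable_swap)
  have h1 : (∀ᵐ ω ∂P, G (fun i => (R i ω, X i ω)) (fun i => (B i ω, Y i ω))) ↔ _ :=
    (ae_map_iff (hB.measurable.prodMk hR.measurable).aemeasurable hG').symm
  rw [h1, map_pair_eq_prod hR hB hRB, Measure.ae_prod_iff_ae_ae hG']
  refine Filter.eventually_congr (Filter.Eventually.of_forall fun q => ?_)
  exact ae_map_iff hR.measurable.aemeasurable (measurable_prodMk_left hG')

variable [IsProbabilityMeasure ν]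

/-- Properties that hold almost surely continue to hold after the addition of almost every red
point. -/
theorem ae_afterAdding (hR : IsMarkedPoissonProcess P lamR ν R X)
    (hB : IsMarkedPoissonProcess P lamB μ B Y)
    (hRB : IndepFun (fun ω i => (R i ω, X i ω)) (fun ω i => (B i ω, Y i ω)) P)
    (hlamR : 0 < lamR) {G : (ℕ → ℝ × ℕ) → (ℕ → ℝ × ℕ) → Prop}
    (hG : Measurable fun c : Config => G c.1 c.2) (hp : ∀ q, PermInvariant fun p => G p q)
    (h : ∀ᵐ ω ∂P, G (fun i => (R i ω, X i ω)) (fun i => (B i ω, Y i ω))) (k : ℕ) :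
    ∀ᵐ ω ∂P, (AfterAdding ν)^[k] G (fun i => (R i ω, X i ω)) (fun i => (B i ω, Y i ω)) := by
  induction k generalizing G with
  | zero => exact h
  | succ k ih =>
    refine ih (measurable_afterAdding hG) (permInvariant_afterAdding hp) ?_
    rw [ae_pair_iff hR hB hRB (measurable_afterAdding hG)]
    filter_upwards [(ae_pair_iff hR hB hRB hG).1 h] with q hq
    exact hR.ae_cons hlamR (G := fun p => G p q)
      (measurableSet_setOfPred.2 (hG.comp measurable_prodMk_right)) (hp q) hq

variable [IsProbabilityMeasure μ]

/-- The joint law of the two unordered marked processes is determined by the parameters. -/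
theorem lintegral_pair_eq (hR : IsMarkedPoissonProcess P lamR ν R X)
    (hB : IsMarkedPoissonProcess P lamB μ B Y)
    (hRB : IndepFun (fun ω i => (R i ω, X i ω)) (fun ω i => (B i ω, Y i ω)) P)
    (hR' : IsMarkedPoissonProcess P' lamR ν R' X')
    (hB' : IsMarkedPoissonProcess P' lamB μ B' Y')
    (hRB' : IndepFun (fun ω i => (R' i ω, X' i ω)) (fun ω i => (B' i ω, Y' i ω)) P')
    (hlamR : 0 < lamR) (hlamB : 0 < lamB)
    {F : (ℕ → ℝ × ℕ) → (ℕ → ℝ × ℕ) → ℝ≥0∞} (hF : Measurable fun c : Config => F c.1 c.2)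
    (h1 : ∀ q, PermInvariant fun p => F p q) (h2 : ∀ p, PermInvariant fun q => F p q) :
    ∫⁻ ω, F (fun i => (R i ω, X i ω)) (fun i => (B i ω, Y i ω)) ∂P =
      ∫⁻ ω, F (fun i => (R' i ω, X' i ω)) (fun i => (B' i ω, Y' i ω)) ∂P' := by
  have hF' : Measurable fun c : Config => F c.2 c.1 := hF.comp measurable_swap
  rw [lintegral_pair hR hB hRB hF, lintegral_pair hR' hB' hRB' hF]
  have h3 : ∀ q, ∫⁻ ω, F (fun i => (R i ω, X i ω)) q ∂P =
      ∫⁻ ω, F (fun i => (R' i ω, X' i ω)) q ∂P' := fun q =>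
    hR.lintegral_eq hR' hlamR (G := fun p => F p q) (hF'.comp measurable_prodMk_left) (h1 q)
  simp_rw [h3]
  have hm : Measurable fun z : (ℕ → ℝ × ℕ) × Ω' => F (fun i => (R' i z.2, X' i z.2)) z.1 :=
    hF'.comp (measurable_fst.prodMk (hR'.measurable.comp measurable_snd))
  exact hB.lintegral_eq hB' hlamB (G := fun q => ∫⁻ ω, F (fun i => (R' i ω, X' i ω)) q ∂P')
    hm.lintegral_prod_right' fun e q => lintegral_congr fun ω => h2 _ e q

end Pairs

/-! ### Absence of ties and invariance under translations -/

section Regularity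

variable {Ω : Type*} [MeasurableSpace Ω] {P : Measure Ω} {lam : ℝ≥0} {T : ℕ → Ω → ℝ}

theorem IsPoissonProcess.measure_eq_point (hT : IsPoissonProcess P lam T) (i : ℕ) (s : ℝ) :
    P {ω | T i ω = s} = 0 := by
  have h := (hT.hasLaw_count {s} (measurableSet_singleton s) (by simp)).map_eq
  have hS : MeasurableSet ({0}ᶜ : Set ℝ≥0∞) := (measurableSet_singleton _).compl
  have h0 : P ((fun ω => countingMeasure (fun i => T i ω) {s}) ⁻¹' {0}ᶜ) = 0 := by
    rw [← Measure.map_apply (hT.measurable_count (measurableSet_singleton s)) hS, h,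
      Measure.map_apply (measurable_of_countable _) hS]
    have : (fun n : ℕ => (n : ℝ≥0∞)) ⁻¹' {0}ᶜ = {0}ᶜ := by ext; simp
    rw [this, prob_compl_eq_one_sub (measurableSet_singleton 0), poissonMeasure_singleton]
    simp
  refine measure_mono_null (fun ω hω => ?_) h0
  simp only [Set.mem_preimage, Set.mem_compl_iff, Set.mem_singleton_iff]
  rw [countingMeasure_eq_encard _ (measurableSet_singleton s), ENat.toENNReal_eq_zero,
    Set.encard_eq_zero]
  exact Set.Nonempty.ne_empty ⟨i, hω⟩

theorem ae_ne_of_indepFun [IsProbabilityMeasure P] {U V : Ω → ℝ} (hU : Measurable U)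
    (hV : Measurable V) (hUV : IndepFun U V P) (h : ∀ s, P {ω | U ω = s} = 0) :
    ∀ᵐ ω ∂P, U ω ≠ V ω := by
  have hS : MeasurableSet {z : ℝ × ℝ | z.2 ≠ z.1} :=
    (measurableSet_eq_fun measurable_snd measurable_fst).compl
  have h1 := (indepFun_iff_map_prod_eq_prod_map_map hV.aemeasurable hU.aemeasurable).1 hUV.symm
  have h2 : (∀ᵐ ω ∂P, U ω ≠ V ω) ↔ _ := (ae_map_iff (hV.prodMk hU).aemeasurable hS).symm
  rw [h2, h1, Measure.ae_prod_iff_ae_ae hS]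
  refine Filter.Eventually.of_forall fun s => ?_
  refine (ae_map_iff hU.aemeasurable (measurable_prodMk_left hS)).2 ?_
  rw [ae_iff]
  simpa using h s

theorem IsPoissonProcess.shift (hT : IsPoissonProcess P lam T) (z : ℝ) :
    IsPoissonProcess P lam fun i ω => T i ω - z := by
  have hm : Measurable fun x : ℝ => x - z := measurable_id.sub_const z
  have hc : ∀ (t : ℕ → ℝ) {A : Set ℝ}, MeasurableSet A →
      countingMeasure (fun i => t i - z) A = countingMeasure t ((fun x => x - z) ⁻¹' A) :=
    fun t A hA => by
      rw [countingMeasure_eq_encard _ hA, countingMeasure_eq_encard _ (hm hA)]; rfl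
  have hvol : ∀ A : Set ℝ, volume ((fun x => x - z) ⁻¹' A) = volume A := fun A => by
    simp_rw [sub_eq_add_neg]
    exact measure_preimage_add_right _ _ _
  refine ⟨fun i => (hT.measurable_point i).sub_const z, ?_, fun A hA hfin => ?_,
    fun n A hA hd => ?_⟩
  · filter_upwards [hT.ae_injective] with ω h i j hij
    exact h (by simpa using hij)
  · simp_rw [hc _ hA]
    rw [← hvol A]
    exact hT.hasLaw_count _ (hm hA) (by rwa [hvol])
  · simp_rw [hc _ (hA _)]
    exact hT.indep_count n _ (fun j => hm (hA j)) fun i j hij => (hd hij).preimage _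

theorem IsMarkedPoissonProcess.shift {ν : Measure ℕ} {D : ℕ → Ω → ℕ}
    (h : IsMarkedPoissonProcess P lam ν T D) (z : ℝ) :
    IsMarkedPoissonProcess P lam ν (fun i ω => T i ω - z) D := by
  refine ⟨h.poisson.shift z, h.measurable_mark, h.hasLaw_mark, h.indep_mark, ?_⟩
  have hm : Measurable fun (t : ℕ → ℝ) i => t i - z :=
    measurable_pi_iff.2 fun i => by fun_prop
  exact h.indep_point_mark.comp hm measurable_id

variable [IsProbabilityMeasure P] {lamR lamB : ℝ≥0} {ν μ : Measure ℕ}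
  {R : ℕ → Ω → ℝ} {X : ℕ → Ω → ℕ} {B : ℕ → Ω → ℝ} {Y : ℕ → Ω → ℕ}

theorem ae_ne (hR : IsMarkedPoissonProcess P lamR ν R X)
    (hB : IsMarkedPoissonProcess P lamB μ B Y)
    (hRB : IndepFun (fun ω i => (R i ω, X i ω)) (fun ω i => (B i ω, Y i ω)) P) :
    ∀ᵐ ω ∂P, ∀ i j, R i ω ≠ B j ω := by
  rw [ae_all_iff]; intro i
  rw [ae_all_iff]; intro j
  have h := hRB.comp (φ := fun p : ℕ → ℝ × ℕ => (p i).1) (ψ := fun q : ℕ → ℝ × ℕ => (q j).1)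
    (by fun_prop) (by fun_prop)
  exact ae_ne_of_indepFun (hR.poisson.measurable_point i) (hB.poisson.measurable_point j) h
    (hR.poisson.measure_eq_point i)

/-- Almost surely, no point of the first process is the midpoint of two points of the second. -/
theorem ae_ne_midpoint (hR : IsMarkedPoissonProcess P lamR ν R X)
    (hB : IsMarkedPoissonProcess P lamB μ B Y)
    (hRB : IndepFun (fun ω i => (R i ω, X i ω)) (fun ω i => (B i ω, Y i ω)) P) :
    ∀ᵐ ω ∂P, ∀ i j j', R i ω ≠ (B j ω + B j' ω) / 2 := by
  rw [ae_all_iff]; intro i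
  rw [ae_all_iff]; intro j
  rw [ae_all_iff]; intro j'
  have h := hRB.comp (φ := fun p : ℕ → ℝ × ℕ => (p i).1)
    (ψ := fun q : ℕ → ℝ × ℕ => ((q j).1 + (q j').1) / 2) (by fun_prop) (by fun_prop)
  exact ae_ne_of_indepFun (hR.poisson.measurable_point i)
    (((hB.poisson.measurable_point j).add (hB.poisson.measurable_point j')).div_const 2) h
    (hR.poisson.measure_eq_point i)

theorem ae_noTies (hR : IsMarkedPoissonProcess P lamR ν R X)
    (hB : IsMarkedPoissonProcess P lamB μ B Y)
    (hRB : IndepFun (fun ω i => (R i ω, X i ω)) (fun ω i => (B i ω, Y i ω)) P) :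
    ∀ᵐ ω ∂P, NoTies (fun i => (R i ω, X i ω)) (fun i => (B i ω, Y i ω)) := by
  filter_upwards [ae_ne_midpoint hR hB hRB, ae_ne_midpoint hB hR hRB.symm,
    hR.poisson.ae_injective, hB.poisson.ae_injective] with ω h1 h2 h3 h4
  refine ⟨fun i j j' h => ?_, fun i i' j h => ?_⟩
  · rcases abs_eq_abs.1 h with h | h
    · exact h4 (by simpa using h)
    · exact absurd (by simp only at h; linarith) (h1 i j j')
  · rcases abs_eq_abs.1 h with h | h
    · exact h3 (by simpa using h)
    · exact absurd (by simp only at h; linarith) (h2 j i i')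

end Regularity

/-! ### The blue points that desire the origin -/

section Origin

variable {Ω : Type*} [MeasurableSpace Ω] {P : Measure Ω} [IsProbabilityMeasure P]
  {lamR lamB : ℝ≥0} {ν μ : Measure ℕ} [IsProbabilityMeasure ν]
  {R : ℕ → Ω → ℝ} {X : ℕ → Ω → ℕ} {B : ℕ → Ω → ℝ} {Y : ℕ → Ω → ℕ}

/-- Almost surely at most one point of the line is desired by finitely many blue points only. -/
theorem ae_not_finitelyDesired_pair (hR : IsMarkedPoissonProcess P lamR ν R X)
    (hB : IsMarkedPoissonProcess P lamB μ B Y)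
    (hRB : IndepFun (fun ω i => (R i ω, X i ω)) (fun ω i => (B i ω, Y i ω)) P)
    (hlamR : 0 < lamR) (hlamB : 0 < lamB) (hν : ν {0} = 0)
    (h : ∀ᵐ ω ∂P, GreedyPerfect (fun i => (R i ω, X i ω)) (fun i => (B i ω, Y i ω))) :
    ∀ᵐ ω ∂P, ∀ a b, a < b →
      FinitelyDesired a (fun i => (R i ω, X i ω)) (fun i => (B i ω, Y i ω)) →
      ¬ FinitelyDesired b (fun i => (R i ω, X i ω)) (fun i => (B i ω, Y i ω)) := by
  have hadd := ae_all_iff.2 fun k => ae_afterAdding hR hB hRB hlamR measurable_greedyPerfect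
    (fun q e p => propext (greedyPerfect_comp p q e)) h k
  filter_upwards [h, hadd, hR.poisson.ae_locFin, hB.poisson.ae_locFin,
    hB.poisson.ae_gaps hlamB] with ω h1 h2 h3 h4 h5 a b hab ha hb
  obtain ⟨K, hK⟩ := exists_no_perfect_extension (p := fun i => (R i ω, X i ω))
    (q := fun i => (B i ω, Y i ω)) h3 h4 h5 h1.2 ha hb
  obtain ⟨p', hp', h6, h7⟩ := exists_extension hν hab K (h2 K)
  exact hK p' _ hp'.1 hp'.2 h6 h7

variable [IsProbabilityMeasure μ]

/-- The probability that `z` is desired by finitely many blue points does not depend on `z`. -/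
theorem measure_finitelyDesired_eq (hR : IsMarkedPoissonProcess P lamR ν R X)
    (hB : IsMarkedPoissonProcess P lamB μ B Y)
    (hRB : IndepFun (fun ω i => (R i ω, X i ω)) (fun ω i => (B i ω, Y i ω)) P)
    (hlamR : 0 < lamR) (hlamB : 0 < lamB) (z : ℝ) :
    P {ω | FinitelyDesired z (fun i => (R i ω, X i ω)) (fun i => (B i ω, Y i ω))} =
      P {ω | FinitelyDesired 0 (fun i => (R i ω, X i ω)) (fun i => (B i ω, Y i ω))} := by
  classical
  set F : (ℕ → ℝ × ℕ) → (ℕ → ℝ × ℕ) → ℝ≥0∞ := fun p q => if FinitelyDesired 0 p q then 1 else 0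
    with hF
  have hFm : Measurable fun c : Config => F c.1 c.2 :=
    Measurable.ite (measurableSet_setOfPred.2 (measurable_finitelyDesired 0)) measurable_const
      measurable_const
  have hsm : Measurable (shift z) := measurable_pi_iff.2 fun i =>
    ((measurable_pi_apply i).fst.sub_const z).prodMk (measurable_pi_apply i).snd
  have key := lintegral_pair_eq (hR.shift z) (hB.shift z) (hRB.comp hsm hsm) hR hB hRB hlamR hlamB
    (F := F) hFm
    (fun q e p => by
      have := finitelyDesired_comp p q e (Equiv.refl ℕ) 0
      simp only [Equiv.coe_refl, Function.comp_id] at this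
      simp only [hF, this])
    (fun p e q => by
      have := finitelyDesired_comp p q (Equiv.refl ℕ) e 0
      simp only [Equiv.coe_refl, Function.comp_id] at this
      simp only [hF, this])
  have hind : ∀ z, P {ω | FinitelyDesired z (fun i => (R i ω, X i ω)) (fun i => (B i ω, Y i ω))} =
      ∫⁻ ω, (if FinitelyDesired z (fun i => (R i ω, X i ω)) (fun i => (B i ω, Y i ω))
        then 1 else 0) ∂P := fun z => by
    rw [← lintegral_indicator_one]
    · rfl
    · exact measurableSet_setOfPred.2
        ((measurable_finitelyDesired z).comp (hR.measurable.prodMk hB.measurable))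
  rw [hind, hind, ← key]
  refine lintegral_congr fun ω => ?_
  have := finitelyDesired_shift z (fun i => (R i ω, X i ω)) (fun i => (B i ω, Y i ω))
  exact if_congr this.symm rfl rfl

/-- The events that a natural number is desired by finitely many blue points only are almost surely
disjoint and have the same probability. -/
theorem ae_not_finitelyDesired_zero (hR : IsMarkedPoissonProcess P lamR ν R X)
    (hB : IsMarkedPoissonProcess P lamB μ B Y)
    (hRB : IndepFun (fun ω i => (R i ω, X i ω)) (fun ω i => (B i ω, Y i ω)) P)
    (hlamR : 0 < lamR) (hlamB : 0 < lamB) (hν : ν {0} = 0)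
    (h : ∀ᵐ ω ∂P, GreedyPerfect (fun i => (R i ω, X i ω)) (fun i => (B i ω, Y i ω))) :
    ∀ᵐ ω ∂P, ¬ FinitelyDesired 0 (fun i => (R i ω, X i ω)) (fun i => (B i ω, Y i ω)) := by
  rw [ae_iff]
  simp only [not_not]
  set E : ℕ → Set Ω := fun n =>
    {ω | FinitelyDesired n (fun i => (R i ω, X i ω)) (fun i => (B i ω, Y i ω))} with hE
  have hpair := ae_not_finitelyDesired_pair hR hB hRB hlamR hlamB hν h
  have hlt : ∀ m n : ℕ, m < n → P (E m ∩ E n) = 0 := fun m n hmn => by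
    refine measure_mono_null (fun ω hω => ?_) (ae_iff.1 hpair)
    intro hno
    exact hno m n (by exact_mod_cast hmn) hω.1 hω.2
  have hdis : Pairwise (Function.onFun (AEDisjoint P) E) := fun m n hmn => by
    rcases lt_or_gt_of_ne hmn with h | h
    · exact hlt m n h
    · exact (show P (E m ∩ E n) = 0 by rw [Set.inter_comm]; exact hlt n m h)
  have hmeas : ∀ n, NullMeasurableSet (E n) P := fun n =>
    (measurableSet_setOfPred.2 ((measurable_finitelyDesired n).comp
      (hR.measurable.prodMk hB.measurable))).nullMeasurableSet
  have hsum := measure_iUnion₀ hdis hmeas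
  simp only [hE, measure_finitelyDesired_eq hR hB hRB hlamR hlamB] at hsum
  by_contra hne
  rw [ENNReal.tsum_const_eq_top_of_ne_zero hne] at hsum
  exact measure_ne_top P _ hsum

end Origin

end StableMatching

theorem proposition4p1 {Ω : Type*} [MeasurableSpace Ω] (P : Measure Ω) [IsProbabilityMeasure P]
    (lamR lamB : ℝ≥0) (hlamR : 0 < lamR) (hlamB : 0 < lamB)
    (ν μ : Measure ℕ) [IsProbabilityMeasure ν] [IsProbabilityMeasure μ]
    (hν : ν {0} = 0) (hμ : μ {0} = 0)
    (hmean : (lamR : ℝ≥0∞) * ∫⁻ n, (n : ℝ≥0∞) ∂ν = (lamB : ℝ≥0∞) * ∫⁻ n, (n : ℝ≥0∞) ∂μ)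
    (R : ℕ → Ω → ℝ) (X : ℕ → Ω → ℕ) (B : ℕ → Ω → ℝ) (Y : ℕ → Ω → ℕ)
    (hR : StableMatching.IsMarkedPoissonProcess P lamR ν R X)
    (hB : StableMatching.IsMarkedPoissonProcess P lamB μ B Y)
    (hRB : IndepFun (fun ω i => (R i ω, X i ω)) (fun ω i => (B i ω, Y i ω)) P)
    (M : Ω → SimpleGraph ℝ)
    (hM : ∀ᵐ ω ∂P, StableMatching.IsStableMultiMatching
      (fun i => R i ω) (fun i => X i ω) (fun j => B j ω) (fun j => Y j ω) (M ω)) :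
    ∀ᵐ ω ∂P, {x ∈ Set.range (fun j => B j ω) | StableMatching.Desires (M ω) x 0}.Infinite := by
  have hgreedy : ∀ᵐ ω ∂P, (∀ i j, R i ω ≠ B j ω) ∧
      StableMatching.NoTies (fun i => (R i ω, X i ω)) (fun j => (B j ω, Y j ω)) ∧
      StableMatching.IsPerfect (fun i => (R i ω, X i ω)) (fun j => (B j ω, Y j ω))
        (fun i j => (M ω).Adj (R i ω) (B j ω)) ∧
      (fun i j => (M ω).Adj (R i ω) (B j ω)) =
        StableMatching.limitGreedy (fun i => (R i ω, X i ω)) (fun j => (B j ω, Y j ω)) := by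
    filter_upwards [hM, StableMatching.ae_ne hR hB hRB, StableMatching.ae_noTies hR hB hRB,
      hR.poisson.ae_locFin, hB.poisson.ae_locFin, hB.poisson.ae_gaps hlamB]
      with ω h1 h2 h3 h4 h5 h6
    have h7 := StableMatching.IsStableMultiMatching.isPerfect (p := fun i => (R i ω, X i ω))
      (q := fun j => (B j ω, Y j ω)) h1 h3 h2
    obtain ⟨ρ, hρ⟩ := StableMatching.exists_rank (p := fun i => (R i ω, X i ω))
      (q := fun j => (B j ω, Y j ω)) h4 h5 h6
    exact ⟨h2, h3, h7, StableMatching.eq_limitGreedy hρ h7.step_iff⟩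
  have hperfect : ∀ᵐ ω ∂P, StableMatching.GreedyPerfect (fun i => (R i ω, X i ω))
      (fun i => (B i ω, Y i ω)) := by
    filter_upwards [hgreedy] with ω h
    exact ⟨h.2.1, h.2.2.2 ▸ h.2.2.1⟩
  filter_upwards [hM, hgreedy, hB.poisson.ae_injective,
    StableMatching.ae_not_finitelyDesired_zero hR hB hRB hlamR hlamB hν hperfect] with ω h1 h2 h3 h4
  rw [StableMatching.FinitelyDesired, ← h2.2.2.2] at h4
  refine (Set.Infinite.image (f := fun j => B j ω) h3.injOn h4).mono ?_
  rintro _ ⟨j, hj, rfl⟩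
  exact ⟨⟨j, rfl⟩, (StableMatching.desires_iff (p := fun i => (R i ω, X i ω))
    (q := fun j => (B j ω, Y j ω)) h1 h2.1 0 j).2 hj⟩
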